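/- Let $\mathbb F=\mathbb Z/2\mathbb Z$. A *plumbing forest* $G$ is a finite forest with vertex set $V$ and an integer framing $m_v$ on each vertex $v$. Let $M$ be its intersection matrix ($M_{vv}=m_v$; for $v\neq w$, $M_{vw}=1$ if $vw$ is an edge and $M_{vw}=0$ otherwise); it defines a bilinear form $x\cdot y$ on $\mathbb Z^V$. Let $\mathrm{Char}(G)$ be the set of homomorphisms $K\colon\mathbb Z^V\to\mathbb Z$ with $K(x)\equiv x\cdot x \pmod 2$ for all $x$, and put $v^*(w)=v\cdot w$. The lattice chain complex $\mathbb{CF}^-(G)$ is the free $\mathbb F[U]$-module on the pairs $[K,E]$ with $K\in\mathrm{Char}(G)$, $E\subseteq V$, with differential $$\partial[K,E]=\sum_{v\in E}U^{a_v[K,E]}[K,E-v]+\sum_{v\in E}U^{b_v[K,E]}[K+2v^*,E-v],$$ where $2f([K,I])=\sum_{v\in I}K(v)+\bigl(\sum_{v\in I}v\bigr)\cdot\bigl(\sum_{v\in I}v\bigr)$, $g([K,E])=\min_{I\subseteq E}f([K,I])$, $a_v[K,E]=g([K,E-v])-g([K,E])$ and $b_v[K,E]=\min_{v\in I\subseteq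 E}f([K,I])-g([K,E])$. The lattice homology $\mathbb{HF}^-(G)$ is the homology of $(\mathbb{CF}^-(G),\partial)$. If $M$ is negative definite, the complex carries three further structures, which are inherited by $\mathbb{HF}^-(G)$: * the splitting according to $\mathrm{Spin}^c(G)=\mathrm{Char}(G)/\!\sim$, where $K\sim K'$ if and only if $K-K'$ is in the subgroup generated by the $2v^*$; * the $\delta$-grading $|E|$ of $U^j[K,E]$; * the rational Maslov grading $-2j+2g([K,E])+|E|+\tfrac14(K^2+|V|)$ of $U^j[K,E]$, where $K^2=K^{T}M^{-1}K$. **Theorem.** Let $G$ be a negative definite plumbing tree (or forest) and let $v_1v_2$ be an edge of $G$. Let $G'$ be the result of blowing up this edge: the edge $v_1v_2$ is removed, the framings of $v_1$ and $v_2$ drop by one, and a new vertex $e$ with framing $-1$ is added and joined to exactly $v_1$ and $v_2$. Then $\mathbb{HF}^-(G)$ and $\mathbb{HF}^-(G')$ are isomorphic: there are a bijection $\sigma\colon\mathrm{Spin}^c(G)\to\mathrm{Spin}^c(G')$ and an isomorphism of $\mathbb F[U]$-modules $\mathbb{HF}^-(G)\cong\mathbb{HF}^-(G')$ which, for every $\mathfrak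 s\in\mathrm{Spin}^c(G)$ and every $k$, maps $\mathbb{HF}^-_k(G,\mathfrak s)$ onto $\mathbb{HF}^-_k(G',\sigma(\mathfrak s))$ and preserves the Maslov grading. -/

import Mathlib

open Polynomial

/-- The field of two elements. -/
abbrev LatticeField : Type := ZMod 2

/-- The homology `ker d / im d` of a module with an endomorphism `d` such that `d² = 0`. -/
abbrev HomologyOf {R M : Type*} [CommRing R] [AddCommGroup M] [Module R M] (d : M →ₗ[R] M) :
    Type _ :=
  LinearMap.ker d ⧸ (LinearMap.range d).submoduleOf (LinearMap.ker d)

/-- The homology class of a cycle. -/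
abbrev homologyClass {R M : Type*} [CommRing R] [AddCommGroup M] [Module R M] (d : M →ₗ[R] M) :
    LinearMap.ker d →ₗ[R] HomologyOf d :=
  ((LinearMap.range d).submoduleOf (LinearMap.ker d)).mkQ

/-- A plumbing graph on the vertex set `V`: a simple graph with an integer framing at every
vertex. -/
structure PlumbingGraph (V : Type*) where
  graph : SimpleGraph V
  framing : V → ℤ

namespace PlumbingGraph

variable {V : Type*} [DecidableEq V] (G : PlumbingGraph V)

open Classical in
/-- The incidence matrix with the framings in the diagonal, that is, the intersection form of the
plumbed 4-manifold in the basis of `H₂` given by the vertices. -/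
noncomputable def interMatrix : Matrix V V ℤ :=
  Matrix.of fun v w => if v = w then G.framing v else if G.graph.Adj v w then 1 else 0

/-- The intersection form is negative definite. -/
def NegDef : Prop := (-(G.interMatrix.map (Int.cast : ℤ → ℝ))).PosDef

/-- Characteristic elements. A homomorphism `K : H₂ → ℤ` is given by its values on the basis of
vertices, and `K x ≡ x · x` mod 2 holds for all `x` if and only if it holds for the vertices
(both sides are additive mod 2). -/
def Char : Type _ := {K : V → ℤ // ∀ v, K v ≡ G.framing v [ZMOD 2]}

/-- `K + 2 v^*`, where `v^*` is the Poincaré dual of `v`, i.e. `v^* (w) = v · w`. -/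
noncomputable def shift (v : V) (K : G.Char) : G.Char :=
  ⟨fun w => K.1 w + 2 * G.interMatrix v w, fun w => by
    refine (K.2 w).symm.trans (Int.modEq_iff_dvd.2 ?_) |>.symm
    simp⟩

theorem shift_apply (v : V) (K : G.Char) (w : V) :
    (G.shift v K).1 w = K.1 w + 2 * G.interMatrix v w := rfl

/-- The `G`-weight `f([K, I])`, given by `2 f([K, I]) = ∑_{v ∈ I} K(v) + (∑_{v ∈ I} v)²`;
the right-hand side is even, see `two_mul_weight`. -/
noncomputable def weight (K : G.Char) (I : Finset V) : ℤ :=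
  (∑ v ∈ I, K.1 v + ∑ v ∈ I, ∑ w ∈ I, G.interMatrix v w) / 2

theorem interMatrix_comm (v w : V) : G.interMatrix v w = G.interMatrix w v := by
  by_cases h : v = w
  · subst h; rfl
  · by_cases hadj : G.graph.Adj v w
    · simp [interMatrix, h, Ne.symm h, hadj, hadj.symm]
    · simp [interMatrix, h, Ne.symm h, hadj, mt G.graph.adj_symm hadj]

theorem two_mul_weight (K : G.Char) (I : Finset V) :
    2 * G.weight K I = ∑ v ∈ I, K.1 v + ∑ v ∈ I, ∑ w ∈ I, G.interMatrix v w := by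
  refine Int.mul_ediv_cancel' ?_
  induction I using Finset.induction_on with
  | empty => simp
  | insert a s ha ih =>
    have h1 : ∑ v ∈ s, G.interMatrix v a = ∑ w ∈ s, G.interMatrix a w :=
      Finset.sum_congr rfl fun v _ => G.interMatrix_comm v a
    have h2 : G.interMatrix a a = G.framing a := by simp [interMatrix]
    have h3 := (K.2 a).dvd
    simp only [Finset.sum_insert ha, Finset.sum_add_distrib, h1, h2]
    omega

theorem weight_insert (K : G.Char) {v : V} {I : Finset V} (hv : v ∉ I) :
    G.weight K (insert v I) = G.weight K {v} + G.weight (G.shift v K) I := by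
  have h1 : ∑ w ∈ I, G.interMatrix w v = ∑ w ∈ I, G.interMatrix v w :=
    Finset.sum_congr rfl fun w _ => G.interMatrix_comm w v
  have e1 := G.two_mul_weight K (insert v I)
  have e2 := G.two_mul_weight K {v}
  have e3 := G.two_mul_weight (G.shift v K) I
  simp only [Finset.sum_insert hv, Finset.sum_add_distrib, Finset.sum_singleton, h1, shift_apply,
    ← Finset.mul_sum] at e1 e2 e3
  omega

/-- The minimal `G`-weight `g([K, E])`. -/
noncomputable def minWeight (K : G.Char) (E : Finset V) : ℤ :=
  E.powerset.inf' ⟨∅, Finset.empty_mem_powerset E⟩ (G.weight K)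

/-- `A_v([K, E]) = g([K, E - v])`. -/
noncomputable def weightA (v : V) (K : G.Char) (E : Finset V) : ℤ :=
  G.minWeight K (E.erase v)

/-- `B_v([K, E])` for `v ∈ E`: the minimum of `f([K, I])` over the sets `v ∈ I ⊆ E`, which are the
sets `J ∪ {v}` with `J ⊆ E - v`. -/
noncomputable def weightB (v : V) (K : G.Char) (E : Finset V) : ℤ :=
  (E.erase v).powerset.inf' ⟨∅, Finset.empty_mem_powerset _⟩ fun J => G.weight K (insert v J)

/-- `a_v[K, E]`. The difference is nonnegative for `v ∈ E`, see `natCast_expA`. -/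
noncomputable def expA (v : V) (K : G.Char) (E : Finset V) : ℕ :=
  (G.weightA v K E - G.minWeight K E).toNat

/-- `b_v[K, E]`. The difference is nonnegative for `v ∈ E`, see `natCast_expB`. -/
noncomputable def expB (v : V) (K : G.Char) (E : Finset V) : ℕ :=
  (G.weightB v K E - G.minWeight K E).toNat

theorem minWeight_le_weightA (v : V) (K : G.Char) (E : Finset V) :
    G.minWeight K E ≤ G.weightA v K E :=
  Finset.inf'_mono _ (Finset.powerset_mono.2 (Finset.erase_subset v E))
    ⟨∅, Finset.empty_mem_powerset _⟩

theorem minWeight_le_weightB {v : V} (K : G.Char) {E : Finset V} (hv : v ∈ E) :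
    G.minWeight K E ≤ G.weightB v K E := by
  refine Finset.le_inf' _ _ fun J hJ => Finset.inf'_le _ ?_
  rw [Finset.mem_powerset] at hJ ⊢
  exact Finset.insert_subset hv (hJ.trans (Finset.erase_subset v E))

theorem natCast_expA (v : V) (K : G.Char) (E : Finset V) :
    (G.expA v K E : ℤ) = G.weightA v K E - G.minWeight K E :=
  Int.toNat_of_nonneg (sub_nonneg.2 (G.minWeight_le_weightA v K E))

theorem natCast_expB {v : V} (K : G.Char) {E : Finset V} (hv : v ∈ E) :
    (G.expB v K E : ℤ) = G.weightB v K E - G.minWeight K E :=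
  Int.toNat_of_nonneg (sub_nonneg.2 (G.minWeight_le_weightB K hv))

theorem weightB_eq (v : V) (K : G.Char) (E : Finset V) :
    G.weightB v K E = G.weight K {v} + G.minWeight (G.shift v K) (E.erase v) := by
  have hJ : ∀ J ∈ (E.erase v).powerset,
      G.weight K (insert v J) = G.weight K {v} + G.weight (G.shift v K) J := fun J hJ =>
    G.weight_insert K fun h => Finset.notMem_erase v E (Finset.mem_powerset.1 hJ h)
  unfold weightB minWeight
  apply le_antisymm
  · obtain ⟨J, hm, he⟩ := Finset.exists_mem_eq_inf' (s := (E.erase v).powerset)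
      ⟨∅, Finset.empty_mem_powerset _⟩ (G.weight (G.shift v K))
    rw [he, ← hJ J hm]
    exact Finset.inf'_le _ hm
  · refine Finset.le_inf' _ _ fun J hm => ?_
    rw [hJ J hm]
    have := Finset.inf'_le (G.weight (G.shift v K)) hm
    linarith

theorem shift_comm (v w : V) (K : G.Char) :
    G.shift v (G.shift w K) = G.shift w (G.shift v K) := by
  apply Subtype.ext
  funext u
  simp only [shift]
  ring

theorem weight_pair (v w : V) (K : G.Char) :
    G.weight K {v} + G.weight (G.shift v K) {w} =
      G.weight K {w} + G.weight (G.shift w K) {v} := by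
  have e1 := G.two_mul_weight K {v}
  have e2 := G.two_mul_weight K {w}
  have e3 := G.two_mul_weight (G.shift v K) {w}
  have e4 := G.two_mul_weight (G.shift w K) {v}
  have h := G.interMatrix_comm v w
  simp only [Finset.sum_singleton, shift_apply] at e1 e2 e3 e4
  omega

/-- The lattice chain complex `CF⁻(G)`: the free `𝔽[U]`-module on the generators `[K, E]`. -/
abbrev LatticeComplex : Type _ := (G.Char × Finset V) →₀ LatticeField[X]

/-- The boundary map `∂` of `CF⁻(G)`; the variable `X` of the polynomial ring is `U`. -/
noncomputable def boundary : G.LatticeComplex →ₗ[LatticeField[X]] G.LatticeComplex :=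
  Finsupp.linearCombination LatticeField[X] fun p =>
    ∑ v ∈ p.2,
      (Finsupp.single (p.1, p.2.erase v) (X ^ G.expA v p.1 p.2) +
        Finsupp.single (G.shift v p.1, p.2.erase v) (X ^ G.expB v p.1 p.2))

theorem boundary_single (K : G.Char) (E : Finset V) (r : LatticeField[X]) :
    G.boundary (Finsupp.single (K, E) r) = r • ∑ v ∈ E,
      (Finsupp.single (K, E.erase v) (X ^ G.expA v K E) +
        Finsupp.single (G.shift v K, E.erase v) (X ^ G.expB v K E)) := by
  simp [boundary]

/-- `∂² = 0`. -/
theorem boundary_boundary (c : G.LatticeComplex) : G.boundary (G.boundary c) = 0 := by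
  suffices h : G.boundary ∘ₗ G.boundary = 0 from LinearMap.congr_fun h c
  refine Finsupp.lhom_ext' fun ⟨K, E⟩ => LinearMap.ext_ring ?_
  simp only [LinearMap.comp_apply, Finsupp.lsingle_apply, LinearMap.zero_apply, boundary_single,
    one_smul, map_sum, map_add, Finset.smul_sum, smul_add, Finsupp.smul_single, smul_eq_mul,
    ← pow_add, ← Finset.sum_add_distrib]
  rw [Finset.sum_sigma']
  refine Finset.sum_involution (fun p _ => ⟨p.2, p.1⟩) ?_ ?_ ?_ ?_
  · rintro ⟨v, w⟩ h
    simp only [Finset.mem_sigma, Finset.mem_erase] at h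
    obtain ⟨hv, hwv, hw⟩ := h
    have hvw : v ∈ E.erase w := Finset.mem_erase.2 ⟨Ne.symm hwv, hv⟩
    have hwv' : w ∈ E.erase v := Finset.mem_erase.2 ⟨hwv, hw⟩
    have hE : (E.erase v).erase w = (E.erase w).erase v := Finset.erase_right_comm
    have key : ∀ (x y : V), x ∈ E → y ∈ E → y ≠ x →
        G.expA x K E + G.expB y K (E.erase x) =
          G.expB y K E + G.expA x (G.shift y K) (E.erase y) := by
      intro x y hx hy hyx
      have h1 := G.natCast_expA x K E
      have h2 := G.natCast_expB K (Finset.mem_erase.2 ⟨hyx, hy⟩ : y ∈ E.erase x)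
      have h3 := G.natCast_expB K hy
      have h4 := G.natCast_expA x (G.shift y K) (E.erase y)
      simp only [weightB_eq, weightA] at h1 h2 h3 h4
      rw [Finset.erase_right_comm] at h4
      omega
    have haa : G.expA v K E + G.expA w K (E.erase v) =
        G.expA w K E + G.expA v K (E.erase w) := by
      have h1 := G.natCast_expA v K E
      have h2 := G.natCast_expA w K (E.erase v)
      have h3 := G.natCast_expA w K E
      have h4 := G.natCast_expA v K (E.erase w)
      simp only [weightA] at h1 h2 h3 h4
      rw [hE] at h2
      omega
    have hbb : G.expB v K E + G.expB w (G.shift v K) (E.erase v) =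
        G.expB w K E + G.expB v (G.shift w K) (E.erase w) := by
      have h1 := G.natCast_expB K hv
      have h2 := G.natCast_expB (G.shift v K) hwv'
      have h3 := G.natCast_expB K hw
      have h4 := G.natCast_expB (G.shift w K) hvw
      simp only [weightB_eq] at h1 h2 h3 h4
      rw [hE, G.shift_comm w v] at h2
      have := G.weight_pair v w K
      omega
    have k1 := key v w hv hw hwv
    have k2 := key w v hw hv (Ne.symm hwv)
    simp only
    rw [haa, hbb, k1, ← k2, hE, G.shift_comm w v]
    have h2 : ∀ c : G.LatticeComplex, c + c = 0 := fun c => by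
      ext1 p
      exact CharTwo.add_self_eq_zero _
    generalize (Finsupp.single (K, (E.erase w).erase v) (X ^ _) : G.LatticeComplex) = c₁
    generalize (Finsupp.single (G.shift w K, (E.erase w).erase v) (X ^ _) : G.LatticeComplex) = c₂
    generalize (Finsupp.single (G.shift v K, (E.erase w).erase v) (X ^ _) : G.LatticeComplex) = c₃
    generalize (Finsupp.single (G.shift v (G.shift w K), (E.erase w).erase v) (X ^ _) : G.LatticeComplex) = c₄
    refine Eq.trans ?_ (h2 (c₁ + c₂ + c₃ + c₄))
    abel
  · rintro ⟨v, w⟩ h _ heq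
    simp only [Finset.mem_sigma, Finset.mem_erase] at h
    simp only [Sigma.mk.injEq] at heq
    exact h.2.1 heq.1
  · rintro ⟨v, w⟩ h
    simp only [Finset.mem_sigma, Finset.mem_erase] at h ⊢
    exact ⟨h.2.2, Ne.symm h.2.1, h.1⟩
  · rintro ⟨v, w⟩ _
    rfl

/-- The lattice homology `HF⁻(G) = ker ∂ / im ∂`, an `𝔽[U]`-module. -/
abbrev LatticeHomology : Type _ := HomologyOf G.boundary

variable [Fintype V]

/-- `K` and `K'` induce the same spin^c structure on the boundary 3-manifold: `K' - K` lies in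
`2 H²(X, Y)`, the group generated by the `2 v^*`. -/
def spincSetoid : Setoid G.Char where
  r K K' := ∃ x : V → ℤ, ∀ w, K'.1 w = K.1 w + 2 * ∑ v, x v * G.interMatrix v w
  iseqv := by
    refine ⟨fun K => ⟨0, by simp⟩, ?_, ?_⟩
    · rintro K K' ⟨x, hx⟩
      refine ⟨-x, fun w => ?_⟩
      simp [hx w]
    · rintro K K' K'' ⟨x, hx⟩ ⟨y, hy⟩
      refine ⟨x + y, fun w => ?_⟩
      rw [hy w, hx w]
      simp only [Pi.add_apply, add_mul, Finset.sum_add_distrib]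
      ring

/-- The spin^c structures of the boundary 3-manifold. -/
def SpinC : Type _ := Quotient G.spincSetoid

/-- The spin^c structure `𝔰_K`. -/
def spinc (K : G.Char) : G.SpinC := Quotient.mk G.spincSetoid K

/-- The rational square `K²`, computed with the inverse of the intersection matrix. -/
noncomputable def charSq (K : G.Char) : ℚ :=
  (fun v => (K.1 v : ℚ)) ⬝ᵥ
    ((G.interMatrix.map (Int.cast : ℤ → ℚ))⁻¹.mulVec fun v => (K.1 v : ℚ))

/-- The Maslov grading of `U^j ⊗ [K, E]`. -/
noncomputable def maslov (j : ℕ) (K : G.Char) (E : Finset V) : ℚ :=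
  -2 * (j : ℚ) + 2 * (G.minWeight K E : ℚ) + (E.card : ℚ) +
    (G.charSq K + (Fintype.card V : ℚ)) / 4

/-- The `𝔽`-subspace of `CF⁻(G)` of chains in the spin^c structure `s`, of `δ`-degree `k` and of
Maslov degree `q`. -/
noncomputable def homogeneousChains (s : G.SpinC) (k : ℕ) (q : ℚ) :
    Submodule LatticeField G.LatticeComplex :=
  Submodule.span LatticeField
    {c | ∃ (j : ℕ) (K : G.Char) (E : Finset V), G.spinc K = s ∧ E.card = k ∧
      G.maslov j K E = q ∧ c = Finsupp.single (K, E) (X ^ j)}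

/-- The part of Maslov degree `q` in `HF⁻_k(G, s)`: the classes of the cycles that are chains in the
spin^c structure `s`, of `δ`-degree `k` and of Maslov degree `q`. -/
noncomputable def homogeneousPart (s : G.SpinC) (k : ℕ) (q : ℚ) :
    Submodule LatticeField G.LatticeHomology :=
  ((G.homogeneousChains s k q).comap
    ((LinearMap.ker G.boundary).subtype.restrictScalars LatticeField)).map
    ((homologyClass G.boundary).restrictScalars LatticeField)

/-- The blow-up of the edge joining `v₁` and `v₂`. The new vertex `none` has framing `-1` and is
joined to `v₁` and `v₂`, which are no longer joined to each other and whose framings drop by one. -/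
def blowUpEdge {V : Type*} [DecidableEq V] (G : PlumbingGraph V) (v₁ v₂ : V) :
    PlumbingGraph (Option V) where
  graph := SimpleGraph.fromRel fun a b =>
    match a, b with
    | none, some w => w = v₁ ∨ w = v₂
    | some u, some w => G.graph.Adj u w ∧ s(u, w) ≠ s(v₁, v₂)
    | _, none => False
  framing := fun a =>
    match a with
    | none => -1
    | some w => if w = v₁ ∨ w = v₂ then G.framing w - 1 else G.framing w

end PlumbingGraph

/-! In the lattice of the blow-up, the total transforms `v + excMult v • e` span a copy of the
lattice of `G` orthogonal to `e`, and `e · e = -1`. So a characteristic element of the blow-up is a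
pair: a characteristic element `K` of `G` and a height `s`, the value on `e` being `1 - 2s`. Over
each `[K, E]` stands an infinite column of base generators, one for each height, consecutive ones
being joined by a vertical cube in the direction `e`. The normalized weight along this column
(`colWeight`) is the minimum over `I ⊆ E` of `f([K, I]) - (s - n)(s - n - 1)/2`, where `n` is the
number of ends of the edge in `I`. It never exceeds `g([K, E])`, it attains this value, and it
decreases weakly on both sides of any height where it does. Attainment is where the forest enters:
failure at the heights 1 and 2 would give one minimizer of `f` with both ends of the edge and one
with neither, and exchanging their parts on one side of this bridge would lower the total weight
(`weight_add_weight_of_bridge`).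

The map `blowDown` kills the vertical cubes and sends a base generator to `[K, E]` times `U` to the
power `g([K, E]) - colWeight`. It is a surjective chain map. Modulo vertical chains and their
boundaries, every generator is a multiple of a maximal one in its column (`single_sub_single_mem`),
so a cycle in the kernel is `∂a + b` with `a`, `b` vertical. Then `b` is a vertical cycle, hence
zero (`eq_zero_of_mem_vertChains`). The kernel is thus acyclic and `blowDown` is a
quasi-isomorphism. It respects the gradings because squares change by `-(1 - 2s)²`; negative
definiteness serves to invert the matrix that defines these squares. -/

section Homology

/-! ### Homology and surjective chain maps -/

variable {R M N : Type*} [CommRing R] [AddCommGroup M] [Module R M] [AddCommGroup N] [Module R N]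

/-- The map on homology induced by a chain map. -/
noncomputable def homologyMap {d : M →ₗ[R] M} {d' : N →ₗ[R] N} (P : M →ₗ[R] N)
    (hP : ∀ c, P (d c) = d' (P c)) : HomologyOf d →ₗ[R] HomologyOf d' :=
  Submodule.mapQ _ _
    (P.restrict (p := LinearMap.ker d) (q := LinearMap.ker d') fun c hc => by
      rw [LinearMap.mem_ker] at hc ⊢
      rw [← hP, hc, map_zero]) (by
    rintro ⟨c, hc⟩ ⟨b, hb⟩
    exact ⟨P b, by rw [← hP, hb]; rfl⟩)

theorem homologyMap_homologyClass {d : M →ₗ[R] M} {d' : N →ₗ[R] N} (P : M →ₗ[R] N)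
    (hP : ∀ c, P (d c) = d' (P c)) (z : M) (hz : z ∈ LinearMap.ker d)
    (hPz : P z ∈ LinearMap.ker d') :
    homologyMap P hP (homologyClass d ⟨z, hz⟩) = homologyClass d' ⟨P z, hPz⟩ := rfl

theorem homologyClass_eq_zero_iff (d : M →ₗ[R] M) (z : LinearMap.ker d) :
    homologyClass d z = 0 ↔ ∃ b, d b = z := by
  rw [homologyClass, Submodule.mkQ_apply, Submodule.Quotient.mk_eq_zero]
  rfl

/-- A surjective chain map with acyclic kernel is a quasi-isomorphism. -/
theorem homologyMap_bijective {d : M →ₗ[R] M} {d' : N →ₗ[R] N} (hd : ∀ c, d (d c) = 0)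
    (P : M →ₗ[R] N) (hP : ∀ c, P (d c) = d' (P c)) (hsurj : Function.Surjective P)
    (hker : ∀ z, P z = 0 → d z = 0 → ∃ y, P y = 0 ∧ d y = z) :
    Function.Bijective (homologyMap P hP) := by
  constructor
  · rw [injective_iff_map_eq_zero]
    intro x hx
    obtain ⟨⟨z, hz⟩, rfl⟩ := Submodule.mkQ_surjective _ x
    have hPz : P z ∈ LinearMap.ker d' := by
      rw [LinearMap.mem_ker] at hz ⊢
      rw [← hP, hz, map_zero]
    change homologyMap P hP (homologyClass d ⟨z, hz⟩) = 0 at hx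
    rw [homologyMap_homologyClass P hP z hz hPz, homologyClass_eq_zero_iff] at hx
    obtain ⟨c, hc⟩ := hx
    obtain ⟨b, rfl⟩ := hsurj c
    -- Subtracting the boundary of a lift of `c` moves the cycle `z` into the kernel of `P`.
    obtain ⟨y, -, hy⟩ := hker (z - d b) (by rw [map_sub, hP, hc, sub_self])
      (by rw [map_sub, hd, LinearMap.mem_ker.1 hz, sub_self])
    exact (homologyClass_eq_zero_iff d _).2 ⟨b + y, by rw [map_add, hy]; abel⟩
  · intro x
    obtain ⟨⟨c, hc⟩, rfl⟩ := Submodule.mkQ_surjective _ x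
    obtain ⟨b, rfl⟩ := hsurj c
    -- A lift `b` of a cycle need not be a cycle, but `d b` lies in the kernel of `P`, and a
    -- correction inside that kernel repairs this.
    obtain ⟨y, hy, hdy⟩ := hker (d b) (by rw [hP, LinearMap.mem_ker.1 hc]) (hd b)
    have hz : b - y ∈ LinearMap.ker d := by rw [LinearMap.mem_ker, map_sub, hdy, sub_self]
    have hPz : P (b - y) = P b := by rw [map_sub, hy, sub_zero]
    refine ⟨homologyClass d ⟨b - y, hz⟩, ?_⟩
    rw [homologyMap_homologyClass P hP _ hz (by rw [hPz]; exact hc)]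
    congr 1
    exact Subtype.ext hPz

end Homology

/-! ### Homogeneous components as spans of monomials -/

section Monomials

variable {F ι κ : Type*} [Field F]

/-- The span of the monomials `X ^ j • i` with `(j, i) ∈ S`. -/
noncomputable def monomialSpan (F : Type*) [Field F] {ι : Type*} (S : Set (ℕ × ι)) :
    Submodule F (ι →₀ F[X]) :=
  Submodule.span F ((fun p : ℕ × ι => Finsupp.single p.2 (X ^ p.1 : F[X])) '' S)

theorem single_mem_monomialSpan {S : Set (ℕ × ι)} {j : ℕ} {i : ι} (h : (j, i) ∈ S) :
    Finsupp.single i (X ^ j : F[X]) ∈ monomialSpan F S :=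
  Submodule.subset_span ⟨(j, i), h, rfl⟩

theorem coeff_eq_zero_of_mem_monomialSpan {S : Set (ℕ × ι)} {c : ι →₀ F[X]}
    (hc : c ∈ monomialSpan F S) {j : ℕ} {i : ι} (h : (j, i) ∉ S) : (c i).coeff j = 0 := by
  classical
  induction hc using Submodule.span_induction with
  | mem x hx =>
    obtain ⟨⟨j', i'⟩, hS, rfl⟩ := hx
    by_cases hi : i' = i
    · subst hi
      have : j ≠ j' := by rintro rfl; exact h hS
      simp [coeff_X_pow, this]
    · simp [hi]
  | zero => simp
  | add x y _ _ hx hy => simp [hx, hy]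
  | smul a x _ hx => simp [hx]

theorem disjoint_monomialSpan_compl (S : Set (ℕ × ι)) :
    Disjoint (monomialSpan F S) (monomialSpan F Sᶜ) := by
  rw [Submodule.disjoint_def]
  intro c h₁ h₂
  ext i j
  by_cases h : (j, i) ∈ S
  · simpa using coeff_eq_zero_of_mem_monomialSpan h₂ (not_not.2 h)
  · simpa using coeff_eq_zero_of_mem_monomialSpan h₁ h

theorem monomialSpan_sup_compl (S : Set (ℕ × ι)) :
    monomialSpan F S ⊔ monomialSpan F Sᶜ = ⊤ := by
  rw [eq_top_iff]
  rintro c -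
  induction c using Finsupp.induction_linear with
  | zero => exact zero_mem _
  | add x y hx hy => exact add_mem hx hy
  | single i p =>
    induction p using Polynomial.induction_on' with
    | add p q hp hq => rw [Finsupp.single_add]; exact add_mem hp hq
    | monomial j a =>
      have : Finsupp.single i (monomial j a) = a • Finsupp.single i (X ^ j : F[X]) := by
        rw [Finsupp.smul_single, smul_X_eq_monomial]
      rw [this]
      refine Submodule.smul_mem _ _ ?_
      by_cases h : (j, i) ∈ S
      · exact Submodule.mem_sup_left (single_mem_monomialSpan h)
      · exact Submodule.mem_sup_right (single_mem_monomialSpan h)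

theorem map_mem_monomialSpan (L : (ι →₀ F[X]) →ₗ[F[X]] (κ →₀ F[X])) {S : Set (ℕ × ι)}
    {T : Set (ℕ × κ)}
    (hL : ∀ j i, (j, i) ∈ S → L (Finsupp.single i (X ^ j)) ∈ monomialSpan F T) {c : ι →₀ F[X]}
    (hc : c ∈ monomialSpan F S) : L c ∈ monomialSpan F T := by
  have : monomialSpan F S ≤ (monomialSpan F T).comap (L.restrictScalars F) := by
    refine Submodule.span_le.2 ?_
    rintro _ ⟨⟨j, i⟩, h, rfl⟩
    exact hL j i h
  exact this hc

/-- If a homogeneous map sends `z` to a homogeneous element, then it sends the part of `z` in the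
corresponding degree to the same element. -/
theorem exists_homogeneous_lift (L : (ι →₀ F[X]) →ₗ[F[X]] (κ →₀ F[X]))
    (d : (ι →₀ F[X]) →ₗ[F[X]] (ι →₀ F[X])) {S S' : Set (ℕ × ι)} {T : Set (ℕ × κ)}
    (hL : ∀ j i, (j, i) ∈ S → L (Finsupp.single i (X ^ j)) ∈ monomialSpan F T)
    (hL' : ∀ j i, (j, i) ∈ Sᶜ → L (Finsupp.single i (X ^ j)) ∈ monomialSpan F Tᶜ)
    (hd : ∀ j i, (j, i) ∈ S → d (Finsupp.single i (X ^ j)) ∈ monomialSpan F S')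
    (hd' : ∀ j i, (j, i) ∈ Sᶜ → d (Finsupp.single i (X ^ j)) ∈ monomialSpan F S'ᶜ)
    {z : ι →₀ F[X]} (hz : d z = 0) (hLz : L z ∈ monomialSpan F T) :
    ∃ y ∈ monomialSpan F S, d y = 0 ∧ L y = L z := by
  obtain ⟨y, hy, y', hy', rfl⟩ := Submodule.mem_sup.1
    (by rw [monomialSpan_sup_compl]; trivial : z ∈ monomialSpan F S ⊔ monomialSpan F Sᶜ)
  refine ⟨y, hy, ?_, ?_⟩
  · refine Submodule.disjoint_def.1 (disjoint_monomialSpan_compl S') _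
      (map_mem_monomialSpan d hd hy) ?_
    rw [map_add] at hz
    rw [eq_neg_of_add_eq_zero_left hz]
    exact neg_mem (map_mem_monomialSpan d hd' hy')
  · have : L y' = 0 := by
      refine Submodule.disjoint_def.1 (disjoint_monomialSpan_compl T) _ ?_
        (map_mem_monomialSpan L hL' hy')
      rw [map_add] at hLz
      simpa using sub_mem hLz (map_mem_monomialSpan L hL hy)
    rw [map_add, this, add_zero]

end Monomials

/-! ### Squares of characteristic elements and homogeneity of the boundary -/

namespace PlumbingGraph

variable {V : Type*} [DecidableEq V] (G : PlumbingGraph V)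

/-- A subset of `E` either avoids or contains `v`. This computes the weight of a vertical cube from
those of its two ends. -/
theorem minWeight_eq_min {v : V} (K : G.Char) {E : Finset V} (hv : v ∈ E) :
    G.minWeight K E = min (G.weightA v K E) (G.weightB v K E) := by
  refine le_antisymm (le_min (G.minWeight_le_weightA v K E) (G.minWeight_le_weightB K hv)) ?_
  refine Finset.le_inf' _ _ fun I hI => ?_
  rw [Finset.mem_powerset] at hI
  by_cases h : v ∈ I
  · refine (min_le_right _ _).trans ?_
    have := Finset.inf'_le (fun J => G.weight K (insert v J))
      (Finset.mem_powerset.2 (Finset.erase_subset_erase v hI))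
    simp only [Finset.insert_erase h] at this
    exact this
  · exact (min_le_left _ _).trans (Finset.inf'_le _
      (Finset.mem_powerset.2 (Finset.subset_erase.2 ⟨hI, h⟩)))

theorem two_mul_weight_singleton (K : G.Char) (v : V) :
    2 * G.weight K {v} = K.1 v + G.interMatrix v v := by
  simpa using G.two_mul_weight K {v}

variable [Fintype V]

theorem isUnit_interMatrix (h : G.NegDef) : IsUnit (G.interMatrix.map (Int.cast : ℤ → ℚ)) := by
  have h1 := h.isUnit
  rw [Matrix.isUnit_iff_isUnit_det, isUnit_iff_ne_zero] at h1 ⊢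
  intro h0
  apply h1
  have e1 : (G.interMatrix.map (Int.cast : ℤ → ℚ)).det = ((G.interMatrix.det : ℤ) : ℚ) :=
    ((Int.castRingHom ℚ).map_det G.interMatrix).symm
  have e2 : (G.interMatrix.map (Int.cast : ℤ → ℝ)).det = ((G.interMatrix.det : ℤ) : ℝ) :=
    ((Int.castRingHom ℝ).map_det G.interMatrix).symm
  rw [e1, Int.cast_eq_zero] at h0
  rw [Matrix.det_neg, e2, h0, Int.cast_zero, mul_zero]

/-- Any solution of `M y = K` computes the square, so the inverse matrix need not be handled again.
-/
theorem charSq_eq (h : IsUnit (G.interMatrix.map (Int.cast : ℤ → ℚ))) (K : G.Char) (y : V → ℚ)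
    (hy : ∀ w, ∑ v, (G.interMatrix w v : ℚ) * y v = K.1 w) :
    G.charSq K = ∑ v, (K.1 v : ℚ) * y v := by
  have : (fun v => (K.1 v : ℚ)) = (G.interMatrix.map (Int.cast : ℤ → ℚ)).mulVec y :=
    funext fun w => (hy w).symm
  rw [charSq, this, Matrix.mulVec_mulVec, Matrix.nonsing_inv_mul _
    ((Matrix.isUnit_iff_isUnit_det _).1 h), Matrix.one_mulVec, ← this]
  rfl

theorem exists_dual (h : IsUnit (G.interMatrix.map (Int.cast : ℤ → ℚ))) (k : V → ℚ) :
    ∃ y : V → ℚ, ∀ w, ∑ v, (G.interMatrix w v : ℚ) * y v = k w := by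
  obtain ⟨y, hy⟩ := Matrix.mulVec_surjective_iff_isUnit.2 h k
  exact ⟨y, fun w => congrFun hy w⟩

/-- `(K + 2v^*)² - K² = 4 (K(v) + v · v)`. In the Maslov grading this change cancels the term `f([K,
v])` of `B_v`. -/
theorem charSq_shift (h : IsUnit (G.interMatrix.map (Int.cast : ℤ → ℚ))) (v : V) (K : G.Char) :
    G.charSq (G.shift v K) = G.charSq K + 8 * G.weight K {v} := by
  obtain ⟨y, hy⟩ := G.exists_dual h fun w => (K.1 w : ℚ)
  rw [G.charSq_eq h K y hy, G.charSq_eq h (G.shift v K) (y + Pi.single v 2)]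
  · have e := congrArg (Int.cast : ℤ → ℚ) (G.two_mul_weight_singleton K v)
    push_cast at e
    have e' := hy v
    simp only [shift_apply, Pi.add_apply, mul_add, Finset.sum_add_distrib, Int.cast_add,
      Int.cast_mul, add_mul, Int.cast_ofNat, mul_assoc, ← Finset.mul_sum, e']
    simp only [Pi.single_apply, mul_ite, mul_zero, Finset.sum_ite_eq', Finset.mem_univ, if_true]
    linarith
  · intro w
    simp only [Pi.add_apply, mul_add, Finset.sum_add_distrib, hy, shift_apply]
    simp [Pi.single_apply, G.interMatrix_comm v w, mul_comm]

theorem spinc_shift (v : V) (K : G.Char) : G.spinc (G.shift v K) = G.spinc K := by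
  refine Quotient.sound (s := G.spincSetoid) (Setoid.symm' _ ⟨Pi.single v 1, fun w => ?_⟩)
  simp [shift_apply, Pi.single_apply]

theorem maslov_expA {v : V} (K : G.Char) {E : Finset V} (hv : v ∈ E) (j : ℕ) :
    G.maslov (j + G.expA v K E) K (E.erase v) + 1 = G.maslov j K E := by
  have e := congrArg (Int.cast : ℤ → ℚ) (G.natCast_expA v K E)
  have e' := congrArg (Nat.cast : ℕ → ℚ) (Finset.card_erase_add_one hv)
  push_cast [weightA] at e e'
  simp only [maslov]
  push_cast
  linarith

theorem maslov_expB (h : IsUnit (G.interMatrix.map (Int.cast : ℤ → ℚ))) {v : V} (K : G.Char)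
    {E : Finset V} (hv : v ∈ E) (j : ℕ) :
    G.maslov (j + G.expB v K E) (G.shift v K) (E.erase v) + 1 = G.maslov j K E := by
  have e := congrArg (Int.cast : ℤ → ℚ) (G.natCast_expB K hv)
  have e' := congrArg (Nat.cast : ℕ → ℚ) (Finset.card_erase_add_one hv)
  rw [weightB_eq] at e
  push_cast at e e'
  simp only [maslov, G.charSq_shift h]
  push_cast
  linarith

/-- The boundary map is homogeneous: it preserves the spin^c structure and lowers both gradings
by one. -/
theorem boundary_monomial_mem (h : IsUnit (G.interMatrix.map (Int.cast : ℤ → ℚ)))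
    (D : Set (G.SpinC × ℕ × ℚ)) (j : ℕ) (i : G.Char × Finset V)
    (hi : (G.spinc i.1, i.2.card, G.maslov j i.1 i.2) ∈ D) :
    G.boundary (Finsupp.single i (X ^ j)) ∈ monomialSpan LatticeField
      {p | (G.spinc p.2.1, p.2.2.card + 1, G.maslov p.1 p.2.1 p.2.2 + 1) ∈ D} := by
  obtain ⟨K, E⟩ := i
  rw [boundary_single, Finset.smul_sum]
  refine sum_mem fun v hv => ?_
  rw [smul_add, Finsupp.smul_single, Finsupp.smul_single, smul_eq_mul, smul_eq_mul, ← pow_add,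
    ← pow_add]
  refine add_mem (single_mem_monomialSpan ?_) (single_mem_monomialSpan ?_)
  · simpa [Finset.card_erase_add_one hv, G.maslov_expA K hv] using hi
  · simpa [Finset.card_erase_add_one hv, G.maslov_expB h K hv, spinc_shift] using hi

/-- A single degree is the case of a singleton `D` in `boundary_monomial_mem`; the complement of
that singleton handles all other degrees at once. -/
theorem homogeneousChains_eq (s : G.SpinC) (k : ℕ) (q : ℚ) :
    G.homogeneousChains s k q = monomialSpan LatticeField
      {p | (G.spinc p.2.1, p.2.2.card, G.maslov p.1 p.2.1 p.2.2) ∈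
        ({(s, k, q)} : Set (G.SpinC × ℕ × ℚ))} := by
  unfold homogeneousChains monomialSpan
  congr 1
  ext c
  constructor
  · rintro ⟨j, K, E, h1, h2, h3, rfl⟩
    exact ⟨(j, K, E), by simp [h1, h2, h3], rfl⟩
  · rintro ⟨⟨j, K, E⟩, h, rfl⟩
    simp only [Set.mem_ofPred_eq, Set.mem_singleton_iff, Prod.mk.injEq] at h
    exact ⟨j, K, E, h.1, h.2.1, h.2.2, rfl⟩

theorem mem_homogeneousPart_iff (s : G.SpinC) (k : ℕ) (q : ℚ) (x : G.LatticeHomology) :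
    x ∈ G.homogeneousPart s k q ↔ ∃ (z : G.LatticeComplex) (hz : z ∈ LinearMap.ker G.boundary),
      z ∈ G.homogeneousChains s k q ∧ homologyClass G.boundary ⟨z, hz⟩ = x := by
  constructor
  · rintro ⟨⟨z, hz⟩, h, rfl⟩
    exact ⟨z, hz, h, rfl⟩
  · rintro ⟨z, hz, h, rfl⟩
    exact ⟨⟨z, hz⟩, h, rfl⟩

end PlumbingGraph

/-! ### Exchanging subsets across a bridge -/

namespace PlumbingGraph

section Weights

variable {V : Type*} [DecidableEq V] (G : PlumbingGraph V)

theorem minWeight_le (K : G.Char) {I E : Finset V} (h : I ⊆ E) :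
    G.minWeight K E ≤ G.weight K I :=
  Finset.inf'_le _ (Finset.mem_powerset.2 h)

theorem exists_minWeight_eq (K : G.Char) (E : Finset V) :
    ∃ I ⊆ E, G.minWeight K E = G.weight K I := by
  obtain ⟨I, hI, h⟩ := Finset.exists_mem_eq_inf' (s := E.powerset)
    ⟨∅, Finset.empty_mem_powerset E⟩ (G.weight K)
  exact ⟨I, Finset.mem_powerset.1 hI, h⟩

theorem two_mul_weight_eq_sum_univ [Fintype V] (K : G.Char) (I : Finset V) :
    2 * G.weight K I = ∑ v, (if v ∈ I then 1 else 0) * K.1 v +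
      ∑ v, ∑ w, G.interMatrix v w * ((if v ∈ I then 1 else 0) * (if w ∈ I then 1 else 0)) := by
  rw [two_mul_weight]
  congr 1
  · simp [Finset.sum_ite_mem]
  · have : ∀ v w, G.interMatrix v w * ((if v ∈ I then 1 else 0) * (if w ∈ I then 1 else 0)) =
        if v ∈ I then (if w ∈ I then G.interMatrix v w else 0) else 0 := by
      intro v w; split_ifs <;> simp
    simp only [this]
    simp [Finset.sum_ite_mem]

/-- Exchanging the parts of two sets on one side of a bridge changes the total weight by one if the
first set contains both ends of the bridge and the second set neither. -/
theorem weight_add_weight_of_bridge [Fintype V] {v₁ v₂ : V} (hne : v₁ ≠ v₂) (A : Set V)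
    (h₁ : v₁ ∈ A) (h₂ : v₂ ∉ A)
    (hA : ∀ v ∈ A, ∀ w ∉ A, G.interMatrix v w = if v = v₁ ∧ w = v₂ then 1 else 0)
    (K : G.Char) {E I J : Finset V} (hIE : I ⊆ E) (hJE : J ⊆ E)
    (hI₁ : v₁ ∈ I) (hI₂ : v₂ ∈ I) (hJ₁ : v₁ ∉ J) (hJ₂ : v₂ ∉ J) :
    2 * G.minWeight K E + 1 ≤ G.weight K I + G.weight K J := by
  classical
  -- `I'` agrees with `I` on the side `A` and with `J` off it, and `J'` conversely; so each of them
  -- contains exactly one end of the bridge.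
  let I' := E.filter fun v => if v ∈ A then v ∈ I else v ∈ J
  let J' := E.filter fun v => if v ∈ A then v ∈ J else v ∈ I
  have hI' : ∀ v, v ∈ I' ↔ if v ∈ A then v ∈ I else v ∈ J := fun v => by
    simp only [I', Finset.mem_filter, and_iff_right_iff_imp]
    split_ifs
    exacts [fun h => hIE h, fun h => hJE h]
  have hJ' : ∀ v, v ∈ J' ↔ if v ∈ A then v ∈ J else v ∈ I := fun v => by
    simp only [J', Finset.mem_filter, and_iff_right_iff_imp]
    split_ifs
    exacts [fun h => hJE h, fun h => hIE h]
  have key : G.weight K I + G.weight K J = G.weight K I' + G.weight K J' + 1 := by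
    have hlin : ∑ v, (if v ∈ I then 1 else 0) * K.1 v + ∑ v, (if v ∈ J then 1 else 0) * K.1 v =
        ∑ v, (if v ∈ I' then 1 else 0) * K.1 v + ∑ v, (if v ∈ J' then 1 else 0) * K.1 v := by
      rw [← Finset.sum_add_distrib, ← Finset.sum_add_distrib]
      refine Finset.sum_congr rfl fun v _ => ?_
      simp only [hI', hJ']
      by_cases hv : v ∈ A
      · simp [hv]
      · simp only [hv, if_false]; ring
    -- Terms within one side are only permuted. Across the sides only the bridge counts, and it is
    -- lost in both orders.
    have hquad : ∀ v w,
        G.interMatrix v w * ((if v ∈ I then 1 else 0) * (if w ∈ I then 1 else 0)) +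
        G.interMatrix v w * ((if v ∈ J then 1 else 0) * (if w ∈ J then 1 else 0)) =
        G.interMatrix v w * ((if v ∈ I' then 1 else 0) * (if w ∈ I' then 1 else 0)) +
        G.interMatrix v w * ((if v ∈ J' then 1 else 0) * (if w ∈ J' then 1 else 0)) +
        ((if v = v₁ ∧ w = v₂ then 1 else 0) + (if v = v₂ ∧ w = v₁ then 1 else 0)) := by
      intro v w
      simp only [hI', hJ']
      by_cases hv : v ∈ A <;> by_cases hw : w ∈ A
      · have e1 : w ≠ v₂ := by rintro rfl; exact h₂ hw
        have e2 : v ≠ v₂ := by rintro rfl; exact h₂ hv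
        simp [hv, hw, e1, e2]
      · have e2 : v ≠ v₂ := by rintro rfl; exact h₂ hv
        rw [hA v hv w hw]
        by_cases h : v = v₁ ∧ w = v₂
        · obtain ⟨rfl, rfl⟩ := h
          simp [hI₁, hI₂, hJ₁, hJ₂, h₁, h₂, hne]
        · simp [h, e2]
      · have e2 : w ≠ v₂ := by rintro rfl; exact h₂ hw
        rw [G.interMatrix_comm v w, hA w hw v hv]
        by_cases h : w = v₁ ∧ v = v₂
        · obtain ⟨rfl, rfl⟩ := h
          simp [hI₁, hI₂, hJ₁, hJ₂, h₁, h₂, hne]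
        · have h' : ¬ (v = v₂ ∧ w = v₁) := fun h' => h h'.symm
          simp only [h, h', e2, and_false, if_false]
          ring
      · have e1 : w ≠ v₁ := by rintro rfl; exact hw h₁
        have e2 : v ≠ v₁ := by rintro rfl; exact hv h₁
        simp only [hv, hw, e1, e2, if_false, false_and, and_false]; ring
    have hsum := Finset.sum_congr (rfl : (Finset.univ : Finset V) = _) fun v _ =>
      Finset.sum_congr (rfl : (Finset.univ : Finset V) = _) fun w _ => hquad v w
    have h2 : ∑ v : V, ∑ w : V, ((if v = v₁ ∧ w = v₂ then (1 : ℤ) else 0) +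
        (if v = v₂ ∧ w = v₁ then 1 else 0)) = 2 := by
      simp [Finset.sum_add_distrib, ite_and]
    simp only [Finset.sum_add_distrib] at hsum h2
    have a1 := G.two_mul_weight_eq_sum_univ K I
    have a2 := G.two_mul_weight_eq_sum_univ K J
    have a3 := G.two_mul_weight_eq_sum_univ K I'
    have a4 := G.two_mul_weight_eq_sum_univ K J'
    linarith
  have b1 := G.minWeight_le K (Finset.filter_subset _ _ : I' ⊆ E)
  have b2 := G.minWeight_le K (Finset.filter_subset _ _ : J' ⊆ E)
  linarith

/-- Every edge of a forest is a bridge; `A` is the component of `v₁` once the edge is deleted. -/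
theorem exists_bridge_side (hforest : G.graph.IsAcyclic) {v₁ v₂ : V}
    (hedge : G.graph.Adj v₁ v₂) :
    ∃ A : Set V, v₁ ∈ A ∧ v₂ ∉ A ∧
      ∀ v ∈ A, ∀ w ∉ A, G.interMatrix v w = if v = v₁ ∧ w = v₂ then 1 else 0 := by
  have hb := SimpleGraph.isAcyclic_iff_forall_isBridge.1 hforest
    ((SimpleGraph.mem_edgeSet _).2 hedge)
  rw [SimpleGraph.isBridge_iff] at hb
  have h₂ : v₂ ∉ {v | (G.graph \ SimpleGraph.fromEdgeSet {s(v₁, v₂)}).Reachable v₁ v} := hb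
  refine ⟨_, SimpleGraph.Reachable.refl v₁, h₂, fun v hv w hw => ?_⟩
  have hvw : v ≠ w := by rintro rfl; exact hw hv
  have hadj : ¬ (G.graph \ SimpleGraph.fromEdgeSet {s(v₁, v₂)}).Adj v w := fun h =>
    hw (SimpleGraph.Reachable.trans hv h.reachable)
  simp only [interMatrix, Matrix.of_apply, if_neg hvw]
  by_cases h : v = v₁ ∧ w = v₂
  · obtain ⟨rfl, rfl⟩ := h
    simp [hedge]
  · rw [if_neg h, if_neg]
    intro hG
    apply hadj
    rw [SimpleGraph.sdiff_adj]
    refine ⟨hG, ?_⟩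
    simp only [SimpleGraph.fromEdgeSet_adj, Set.mem_singleton_iff, Sym2.eq_iff, not_and]
    rintro (h' | ⟨rfl, rfl⟩)
    · exact absurd h' h
    · exact absurd hv h₂

end Weights

/-! ### The exceptional weight -/

/-- The weight of `s` times the exceptional class. -/
def excWeight (s : ℤ) : ℤ := -(s * (s - 1) / 2)

theorem two_mul_excWeight (s : ℤ) : 2 * excWeight s = -(s * (s - 1)) := by
  have := Int.mul_ediv_cancel' (Int.even_mul_pred_self s).two_dvd
  unfold excWeight
  linarith

theorem excWeight_add_one (s : ℤ) : excWeight (s + 1) = excWeight s - s := by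
  have h1 := two_mul_excWeight s
  have h2 := two_mul_excWeight (s + 1)
  linarith

theorem excWeight_nonpos (s : ℤ) : excWeight s ≤ 0 := by
  have h1 := two_mul_excWeight s
  have : 0 ≤ s * (s - 1) := by
    rcases le_or_gt s 0 with h | h
    · exact mul_nonneg_of_nonpos_of_nonpos h (by linarith)
    · exact mul_nonneg h.le (by linarith [Int.add_one_le_iff.2 h])
  linarith

/-- The concave parabola `-s(s - 1)/2` has its integral maxima at 0 and 1; this is strict growth on
the left of them, and the next lemma is strict decay on the right. -/
theorem excWeight_lt_of_lt_of_neg {s t : ℤ} (h : s < t) (ht : t < 0) :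
    excWeight s < excWeight t := by
  have h1 := two_mul_excWeight s
  have h2 := two_mul_excWeight t
  nlinarith

theorem excWeight_lt_of_gt {s t : ℤ} (h : t < s) (ht : 1 < t) :
    excWeight s < excWeight t := by
  have h1 := two_mul_excWeight s
  have h2 := two_mul_excWeight t
  nlinarith

/-! ### Intersection form and characteristic elements of the blow-up -/

variable {V : Type*} [DecidableEq V] (G : PlumbingGraph V) (v₁ v₂ : V)

/-- The multiplicity of the exceptional class in the total transform of a vertex. -/
def excMult (v : V) : ℤ := if v = v₁ ∨ v = v₂ then 1 else 0

theorem blowUpEdge_framing_some (w : V) : (G.blowUpEdge v₁ v₂).framing (some w) =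
    if w = v₁ ∨ w = v₂ then G.framing w - 1 else G.framing w := rfl

theorem blowUpEdge_framing_none : (G.blowUpEdge v₁ v₂).framing none = -1 := rfl

theorem blowUpEdge_adj_some_some (u w : V) :
    (G.blowUpEdge v₁ v₂).graph.Adj (some u) (some w) ↔
      G.graph.Adj u w ∧ s(u, w) ≠ s(v₁, v₂) := by
  have h1 : (G.graph.Adj w u ∧ s(w, u) ≠ s(v₁, v₂)) ↔
      (G.graph.Adj u w ∧ s(u, w) ≠ s(v₁, v₂)) := by
    rw [Sym2.eq_swap, G.graph.adj_comm]
  refine (SimpleGraph.fromRel_adj _ _ _).trans ?_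
  refine (and_congr_right fun _ => or_congr_right h1).trans ?_
  rw [or_self, and_iff_right_iff_imp]
  rintro ⟨h, -⟩ he
  exact h.ne (Option.some.inj he)

theorem blowUpEdge_interMatrix_none_none : (G.blowUpEdge v₁ v₂).interMatrix none none = -1 := by
  simp [interMatrix, blowUpEdge]

theorem blowUpEdge_interMatrix_none_some (w : V) :
    (G.blowUpEdge v₁ v₂).interMatrix none (some w) = excMult v₁ v₂ w := by
  simp [interMatrix, blowUpEdge, excMult]

theorem blowUpEdge_interMatrix_some_none (w : V) :
    (G.blowUpEdge v₁ v₂).interMatrix (some w) none = excMult v₁ v₂ w := by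
  rw [interMatrix_comm, blowUpEdge_interMatrix_none_some]

variable {v₁ v₂}

/-- A vertex of the blow-up is its total transform minus `excMult • e`, with `e` orthogonal to total
transforms and of square `-1`. The product term both lowers the two framings and removes the edge.
-/
theorem blowUpEdge_interMatrix_some_some (hedge : G.graph.Adj v₁ v₂) (u w : V) :
    (G.blowUpEdge v₁ v₂).interMatrix (some u) (some w) =
      G.interMatrix u w - excMult v₁ v₂ u * excMult v₁ v₂ w := by
  have hne := hedge.ne
  by_cases huw : u = w
  · subst huw
    simp only [interMatrix, blowUpEdge, excMult, Matrix.of_apply, if_true]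
    split_ifs <;> simp
  · have hadj := G.blowUpEdge_adj_some_some v₁ v₂ u w
    simp only [interMatrix, Matrix.of_apply, Option.some.injEq, huw, if_false, excMult]
    by_cases h : s(u, w) = s(v₁, v₂)
    · have hadj' : ¬ (G.blowUpEdge v₁ v₂).graph.Adj (some u) (some w) := fun h' =>
        (hadj.1 h').2 h
      rw [if_neg hadj']
      rcases Sym2.eq_iff.1 h with ⟨rfl, rfl⟩ | ⟨rfl, rfl⟩
      · simp [hedge]
      · simp [hedge.symm]
    · have h2 := h
      rw [Sym2.eq_iff] at h2
      have hmul : (if u = v₁ ∨ u = v₂ then (1 : ℤ) else 0) * (if w = v₁ ∨ w = v₂ then 1 else 0) =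
          0 := by
        by_cases hu : u = v₁ ∨ u = v₂
        · rw [if_neg (c := w = v₁ ∨ w = v₂), mul_zero]
          rcases hu with rfl | rfl <;> rintro (rfl | rfl) <;> simp_all
        · simp [hu]
      rw [hmul, sub_zero]
      by_cases ha : G.graph.Adj u w
      · rw [if_pos ha, if_pos (hadj.2 ⟨ha, h⟩)]
      · rw [if_neg ha, if_neg fun h' => ha (hadj.1 h').1]

variable (v₁ v₂)

/-- The restriction of a characteristic element of the blow-up to the total transforms of the
vertices. -/
def projChar (K : (G.blowUpEdge v₁ v₂).Char) : G.Char :=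
  ⟨fun v => K.1 (some v) + excMult v₁ v₂ v * K.1 none, fun v => by
    have h1 := (K.2 (some v)).dvd
    have h2 := (K.2 none).dvd
    rw [blowUpEdge_framing_some] at h1
    rw [blowUpEdge_framing_none] at h2
    refine (Int.modEq_iff_dvd.2 ?_)
    beta_reduce
    generalize K.1 none = a at *
    generalize K.1 (some v) = b at *
    unfold excMult
    split_ifs at h1 ⊢ <;> omega⟩

/-- The coordinate of a characteristic element of the blow-up in the exceptional direction. -/
def excCoord (K : (G.blowUpEdge v₁ v₂).Char) : ℤ := (1 - K.1 none) / 2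

/-- The characteristic element of the blow-up with given restriction to the total transforms and
given exceptional coordinate. -/
def liftChar (K : G.Char) (s : ℤ) : (G.blowUpEdge v₁ v₂).Char :=
  ⟨fun a => match a with
    | none => 1 - 2 * s
    | some v => K.1 v - excMult v₁ v₂ v * (1 - 2 * s), fun a => by
    rw [Int.modEq_iff_dvd]
    match a with
    | none => simp only [blowUpEdge]; omega
    | some v =>
      have h := (K.2 v).dvd
      simp only [blowUpEdge, excMult]
      split_ifs <;> omega⟩

theorem liftChar_none (K : G.Char) (s : ℤ) : (G.liftChar v₁ v₂ K s).1 none = 1 - 2 * s := rfl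

theorem liftChar_some (K : G.Char) (s : ℤ) (v : V) :
    (G.liftChar v₁ v₂ K s).1 (some v) = K.1 v - excMult v₁ v₂ v * (1 - 2 * s) := rfl

theorem projChar_apply (K : (G.blowUpEdge v₁ v₂).Char) (v : V) :
    (G.projChar v₁ v₂ K).1 v = K.1 (some v) + excMult v₁ v₂ v * K.1 none := rfl

theorem projChar_liftChar (K : G.Char) (s : ℤ) : G.projChar v₁ v₂ (G.liftChar v₁ v₂ K s) = K := by
  apply Subtype.ext
  funext v
  rw [projChar_apply, liftChar_none, liftChar_some]
  ring

theorem excCoord_liftChar (K : G.Char) (s : ℤ) :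
    G.excCoord v₁ v₂ (G.liftChar v₁ v₂ K s) = s := by
  rw [excCoord, liftChar_none]
  omega

theorem one_sub_two_mul_excCoord (K : (G.blowUpEdge v₁ v₂).Char) :
    1 - 2 * G.excCoord v₁ v₂ K = K.1 none := by
  have h := (K.2 none).dvd
  simp only [blowUpEdge] at h
  unfold excCoord
  omega

theorem liftChar_projChar (K : (G.blowUpEdge v₁ v₂).Char) :
    G.liftChar v₁ v₂ (G.projChar v₁ v₂ K) (G.excCoord v₁ v₂ K) = K := by
  apply Subtype.ext
  funext a
  match a with
  | none => rw [liftChar_none, one_sub_two_mul_excCoord]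
  | some v =>
    rw [liftChar_some, one_sub_two_mul_excCoord, projChar_apply]
    ring

theorem liftChar_inj {K L : G.Char} {s t : ℤ} :
    G.liftChar v₁ v₂ K s = G.liftChar v₁ v₂ L t ↔ K = L ∧ s = t := by
  constructor
  · intro h
    exact ⟨by simpa [projChar_liftChar] using congrArg (G.projChar v₁ v₂) h,
      by simpa [excCoord_liftChar] using congrArg (G.excCoord v₁ v₂) h⟩
  · rintro ⟨rfl, rfl⟩; rfl

theorem shift_none_liftChar (K : G.Char) (s : ℤ) :
    (G.blowUpEdge v₁ v₂).shift none (G.liftChar v₁ v₂ K s) = G.liftChar v₁ v₂ K (s + 1) := by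
  apply Subtype.ext
  funext a
  rw [shift_apply]
  match a with
  | none => rw [liftChar_none, liftChar_none, blowUpEdge_interMatrix_none_none]; ring
  | some v => rw [liftChar_some, liftChar_some, blowUpEdge_interMatrix_none_some]; ring

variable {v₁ v₂}

/-- Subtracting `excMult v • e` from the total transform of `v` lowers the height, as adding `e`
raises it. -/
theorem shift_some_liftChar (hedge : G.graph.Adj v₁ v₂) (v : V) (K : G.Char) (s : ℤ) :
    (G.blowUpEdge v₁ v₂).shift (some v) (G.liftChar v₁ v₂ K s) =
      G.liftChar v₁ v₂ (G.shift v K) (s - excMult v₁ v₂ v) := by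
  apply Subtype.ext
  funext a
  rw [shift_apply]
  match a with
  | none => rw [liftChar_none, liftChar_none, blowUpEdge_interMatrix_some_none]; ring
  | some w =>
    rw [liftChar_some, liftChar_some, G.blowUpEdge_interMatrix_some_some hedge, shift_apply]; ring

/-- The vertices of `I` add up to a total transform minus `n • e`, with `n` the sum of
multiplicities. By orthogonality the weight splits, and the second part is `(-n(1 - 2s) - n²)/2`. -/
theorem weight_liftChar_map_some (hedge : G.graph.Adj v₁ v₂) (K : G.Char) (s : ℤ) (I : Finset V) :
    (G.blowUpEdge v₁ v₂).weight (G.liftChar v₁ v₂ K s) (I.map Function.Embedding.some) =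
      G.weight K I + excWeight (s - ∑ v ∈ I, excMult v₁ v₂ v) - excWeight s := by
  have h1 := (G.blowUpEdge v₁ v₂).two_mul_weight (G.liftChar v₁ v₂ K s)
    (I.map Function.Embedding.some)
  have h2 := G.two_mul_weight K I
  have h3 := two_mul_excWeight s
  have h4 := two_mul_excWeight (s - ∑ v ∈ I, excMult v₁ v₂ v)
  simp only [Finset.sum_map, Function.Embedding.some_apply, liftChar_some,
    G.blowUpEdge_interMatrix_some_some hedge, Finset.sum_sub_distrib, ← Finset.sum_mul,
    ← Finset.mul_sum] at h1
  generalize ∑ v ∈ I, excMult v₁ v₂ v = n at *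
  have : 2 * (G.blowUpEdge v₁ v₂).weight (G.liftChar v₁ v₂ K s) (I.map Function.Embedding.some) =
      2 * (G.weight K I + excWeight (s - n) - excWeight s) := by
    linarith
  linarith

theorem weight_liftChar_some (hedge : G.graph.Adj v₁ v₂) (K : G.Char) (s : ℤ) (v : V) :
    (G.blowUpEdge v₁ v₂).weight (G.liftChar v₁ v₂ K s) {some v} =
      G.weight K {v} + excWeight (s - excMult v₁ v₂ v) - excWeight s := by
  simpa using G.weight_liftChar_map_some hedge K s {v}

variable (v₁ v₂)

theorem weight_liftChar_none (K : G.Char) (s : ℤ) :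
    (G.blowUpEdge v₁ v₂).weight (G.liftChar v₁ v₂ K s) {none} = -s := by
  have := (G.blowUpEdge v₁ v₂).two_mul_weight_singleton (G.liftChar v₁ v₂ K s) none
  rw [liftChar_none, blowUpEdge_interMatrix_none_none] at this
  linarith

/-! ### Weights along a column -/

/-- The normalized weight of the cube spanned by `E` at height `s` over `K`. -/
noncomputable def colWeight (K : G.Char) (E : Finset V) (s : ℤ) : ℤ :=
  (G.blowUpEdge v₁ v₂).minWeight (G.liftChar v₁ v₂ K s) (E.map Function.Embedding.some) +
    excWeight s

variable {v₁ v₂}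

theorem colWeight_le (hedge : G.graph.Adj v₁ v₂) (K : G.Char) {I E : Finset V} (h : I ⊆ E)
    (s : ℤ) : G.colWeight v₁ v₂ K E s ≤
      G.weight K I + excWeight (s - ∑ v ∈ I, excMult v₁ v₂ v) := by
  have h1 := (G.blowUpEdge v₁ v₂).minWeight_le (G.liftChar v₁ v₂ K s)
    (Finset.map_subset_map (f := Function.Embedding.some) |>.2 h)
  rw [G.weight_liftChar_map_some hedge] at h1
  unfold colWeight
  linarith

theorem exists_colWeight_eq (hedge : G.graph.Adj v₁ v₂) (K : G.Char) (E : Finset V) (s : ℤ) :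
    ∃ I ⊆ E, G.colWeight v₁ v₂ K E s =
      G.weight K I + excWeight (s - ∑ v ∈ I, excMult v₁ v₂ v) := by
  obtain ⟨I', hI', h⟩ := (G.blowUpEdge v₁ v₂).exists_minWeight_eq (G.liftChar v₁ v₂ K s)
    (E.map Function.Embedding.some)
  obtain ⟨I, hI, rfl⟩ := Finset.subset_map_iff.1 hI'
  refine ⟨I, hI, ?_⟩
  rw [G.weight_liftChar_map_some hedge] at h
  unfold colWeight
  linarith

theorem colWeight_le_minWeight (hedge : G.graph.Adj v₁ v₂) (K : G.Char) (E : Finset V) (s : ℤ) :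
    G.colWeight v₁ v₂ K E s ≤ G.minWeight K E := by
  obtain ⟨I, hI, h⟩ := G.exists_minWeight_eq K E
  have h1 := G.colWeight_le hedge K hI s
  have h2 := excWeight_nonpos (s - ∑ v ∈ I, excMult v₁ v₂ v)
  linarith

/-- The weight is nonincreasing along a column above any of its maxima. -/
theorem colWeight_add_one_le (hedge : G.graph.Adj v₁ v₂) (K : G.Char) (E : Finset V) {s t : ℤ}
    (ht : G.colWeight v₁ v₂ K E t = G.minWeight K E) (hts : t ≤ s) :
    G.colWeight v₁ v₂ K E (s + 1) ≤ G.colWeight v₁ v₂ K E s := by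
  obtain ⟨I, hI, h⟩ := G.exists_colWeight_eq hedge K E s
  have h1 := G.colWeight_le hedge K hI (s + 1)
  have h2 := G.colWeight_le hedge K hI t
  have h3 := G.colWeight_le_minWeight hedge K E s
  have h4 := G.colWeight_le_minWeight hedge K E (s + 1)
  generalize ∑ v ∈ I, excMult v₁ v₂ v = n at *
  rcases eq_or_lt_of_le hts with rfl | hts
  · linarith
  -- If `s - n` is negative, the parabola is strictly lower at `t - n`, so the same `I` would push
  -- the weight at `t` below its maximum. Otherwise the parabola does not increase from `s - n` to
  -- the next integer.
  by_cases hn : s - n < 0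
  · have := excWeight_lt_of_lt_of_neg (s := t - n) (t := s - n) (by linarith) hn
    linarith
  · have := excWeight_add_one (s - n)
    rw [sub_add_eq_add_sub] at this
    linarith

/-- The weight is nondecreasing along a column below any of its maxima. -/
theorem colWeight_le_add_one (hedge : G.graph.Adj v₁ v₂) (K : G.Char) (E : Finset V) {s t : ℤ}
    (ht : G.colWeight v₁ v₂ K E t = G.minWeight K E) (hts : s + 1 ≤ t) :
    G.colWeight v₁ v₂ K E s ≤ G.colWeight v₁ v₂ K E (s + 1) := by
  obtain ⟨I, hI, h⟩ := G.exists_colWeight_eq hedge K E (s + 1)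
  have h1 := G.colWeight_le hedge K hI s
  have h2 := G.colWeight_le hedge K hI t
  have h3 := G.colWeight_le_minWeight hedge K E s
  have h4 := G.colWeight_le_minWeight hedge K E (s + 1)
  generalize ∑ v ∈ I, excMult v₁ v₂ v = n at *
  rcases eq_or_lt_of_le hts with rfl | hts
  · linarith
  -- The mirror image: beyond 1 the parabola would be strictly lower at `t - n`.
  by_cases hn : 1 < s + 1 - n
  · have := excWeight_lt_of_gt (s := t - n) (t := s + 1 - n) (by linarith) hn
    linarith
  · have := excWeight_add_one (s - n)
    rw [sub_add_eq_add_sub] at this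
    linarith

theorem sum_excMult (hne : v₁ ≠ v₂) (I : Finset V) :
    ∑ v ∈ I, excMult v₁ v₂ v = (if v₁ ∈ I then 1 else 0) + (if v₂ ∈ I then 1 else 0) := by
  have : ∀ v, excMult v₁ v₂ v = (if v = v₁ then 1 else 0) + (if v = v₂ then 1 else 0) := by
    intro v
    unfold excMult
    by_cases h : v = v₁
    · subst h; simp [hne]
    · simp [h]
  simp [this, Finset.sum_add_distrib]

/-- In a forest the weight along a column reaches the minimal weight of the cube below. -/
theorem exists_colWeight_eq_minWeight [Fintype V] (hforest : G.graph.IsAcyclic)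
    (hedge : G.graph.Adj v₁ v₂) (K : G.Char) (E : Finset V) :
    ∃ s, G.colWeight v₁ v₂ K E s = G.minWeight K E := by
  obtain ⟨A, h₁, h₂, hA⟩ := G.exists_bridge_side hforest hedge
  by_contra! hcon
  have hlt : ∀ s, G.colWeight v₁ v₂ K E s < G.minWeight K E := fun s =>
    lt_of_le_of_ne (G.colWeight_le_minWeight hedge K E s) (hcon s)
  have e2 : excWeight 2 = -1 := by decide
  have e1 : excWeight 1 = 0 := by decide
  have e0 : excWeight 0 = 0 := by decide
  have e3 : excWeight (-1) = -1 := by decide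
  -- At height 1 only sets with `n = 2` are penalized, at height 2 only those with `n = 0`, each
  -- time by exactly 1. So failure at both heights forces `I` and `J` to be minimizers of the two
  -- kinds.
  obtain ⟨I, hI, hIw⟩ := G.exists_colWeight_eq hedge K E 1
  obtain ⟨J, hJ, hJw⟩ := G.exists_colWeight_eq hedge K E 2
  have hI1 := hlt 1
  have hJ1 := hlt 2
  have hI2 := G.minWeight_le K hI
  have hJ2 := G.minWeight_le K hJ
  rw [hIw, sum_excMult hedge.ne] at hI1
  rw [hJw, sum_excMult hedge.ne] at hJ1
  have hI3 : v₁ ∈ I ∧ v₂ ∈ I ∧ G.weight K I - 1 < G.minWeight K E := by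
    by_cases a : v₁ ∈ I <;> by_cases b : v₂ ∈ I <;> simp [a, b, e0, e1, e3] at hI1 ⊢ <;> linarith
  have hJ3 : v₁ ∉ J ∧ v₂ ∉ J ∧ G.weight K J - 1 < G.minWeight K E := by
    by_cases a : v₁ ∈ J <;> by_cases b : v₂ ∈ J <;> simp [a, b, e0, e1, e2] at hJ1 ⊢ <;> linarith
  have := G.weight_add_weight_of_bridge hedge.ne A h₁ h₂ hA K hI hJ hI3.1 hI3.2.1 hJ3.1 hJ3.2.1
  linarith [hI3.2.2, hJ3.2.2, Int.add_one_le_iff.2 hI3.2.2, Int.add_one_le_iff.2 hJ3.2.2]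

end PlumbingGraph

/-! ### Generators and boundary of the blown-up complex -/

namespace PlumbingGraph

variable {V : Type*} [DecidableEq V] (G : PlumbingGraph V) (v₁ v₂ : V)

/-- The generator of `CF⁻` of the blow-up at height `s` over `[K, E]`, without the exceptional
direction. -/
def baseGen (K : G.Char) (s : ℤ) (E : Finset V) :
    (G.blowUpEdge v₁ v₂).Char × Finset (Option V) :=
  (G.liftChar v₁ v₂ K s, E.map Function.Embedding.some)

/-- The generator of `CF⁻` of the blow-up over `[K, E]` spanned by `E` and the exceptional
direction, between the heights `s` and `s + 1`. -/
def vertGen (K : G.Char) (s : ℤ) (E : Finset V) :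
    (G.blowUpEdge v₁ v₂).Char × Finset (Option V) :=
  (G.liftChar v₁ v₂ K s, insert none (E.map Function.Embedding.some))

theorem gen_cases {motive : (G.blowUpEdge v₁ v₂).Char × Finset (Option V) → Prop}
    (base : ∀ K s E, motive (G.baseGen v₁ v₂ K s E))
    (vert : ∀ K s E, motive (G.vertGen v₁ v₂ K s E)) (p) : motive p := by
  obtain ⟨K, E⟩ := p
  by_cases h : none ∈ E
  · have := vert (G.projChar v₁ v₂ K) (G.excCoord v₁ v₂ K) E.eraseNone
    rwa [vertGen, liftChar_projChar, Finset.map_some_eraseNone, Finset.insert_erase h] at this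
  · have := base (G.projChar v₁ v₂ K) (G.excCoord v₁ v₂ K) E.eraseNone
    rwa [baseGen, liftChar_projChar, Finset.map_some_eraseNone, Finset.erase_eq_of_notMem h]
      at this

theorem baseGen_inj {K L : G.Char} {s t : ℤ} {E F : Finset V} :
    G.baseGen v₁ v₂ K s E = G.baseGen v₁ v₂ L t F ↔ K = L ∧ s = t ∧ E = F := by
  rw [baseGen, baseGen, Prod.mk.injEq, liftChar_inj, Finset.map_inj, and_assoc]

theorem none_notMem_map_some {V : Type*} (E : Finset V) : none ∉ E.map Function.Embedding.some := by simp

theorem vertGen_inj {K L : G.Char} {s t : ℤ} {E F : Finset V} :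
    G.vertGen v₁ v₂ K s E = G.vertGen v₁ v₂ L t F ↔ K = L ∧ s = t ∧ E = F := by
  rw [vertGen, vertGen, Prod.mk.injEq, liftChar_inj, and_assoc]
  refine and_congr_right fun _ => and_congr_right fun _ => ⟨fun h => ?_, fun h => by rw [h]⟩
  have := congrArg (fun S => Finset.erase S none) h
  simp only [Finset.erase_insert (none_notMem_map_some _)] at this
  exact Finset.map_injective _ this

theorem vertGen_ne_baseGen {K L : G.Char} {s t : ℤ} {E F : Finset V} :
    G.vertGen v₁ v₂ K s E ≠ G.baseGen v₁ v₂ L t F := by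
  intro h
  refine none_notMem_map_some F ?_
  rw [← (Prod.mk.inj h).2]
  exact Finset.mem_insert_self _ _

theorem weightA_none (K : G.Char) (s : ℤ) (E : Finset V) :
    (G.blowUpEdge v₁ v₂).weightA none (G.liftChar v₁ v₂ K s)
      (insert none (E.map Function.Embedding.some)) = G.colWeight v₁ v₂ K E s - excWeight s := by
  rw [weightA, Finset.erase_insert (none_notMem_map_some E), colWeight, add_sub_cancel_right]

/-- The weight `-s` of the exceptional vertex is the increment of `excWeight`, so both ends of a
vertical cube carry the same normalization `-excWeight s`. -/
theorem weightB_none (K : G.Char) (s : ℤ) (E : Finset V) :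
    (G.blowUpEdge v₁ v₂).weightB none (G.liftChar v₁ v₂ K s)
      (insert none (E.map Function.Embedding.some)) =
      G.colWeight v₁ v₂ K E (s + 1) - excWeight s := by
  rw [weightB_eq, Finset.erase_insert (none_notMem_map_some E), shift_none_liftChar,
    weight_liftChar_none, colWeight, excWeight_add_one]
  ring

theorem natCast_expA_none (K : G.Char) (s : ℤ) (E : Finset V) :
    ((G.blowUpEdge v₁ v₂).expA none (G.liftChar v₁ v₂ K s)
      (insert none (E.map Function.Embedding.some)) : ℤ) = G.colWeight v₁ v₂ K E s -
        min (G.colWeight v₁ v₂ K E s) (G.colWeight v₁ v₂ K E (s + 1)) := by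
  rw [natCast_expA, minWeight_eq_min _ _ (Finset.mem_insert_self _ _), weightA_none, weightB_none]
  omega

theorem natCast_expB_none (K : G.Char) (s : ℤ) (E : Finset V) :
    ((G.blowUpEdge v₁ v₂).expB none (G.liftChar v₁ v₂ K s)
      (insert none (E.map Function.Embedding.some)) : ℤ) = G.colWeight v₁ v₂ K E (s + 1) -
        min (G.colWeight v₁ v₂ K E s) (G.colWeight v₁ v₂ K E (s + 1)) := by
  rw [natCast_expB _ _ (Finset.mem_insert_self _ _),
    minWeight_eq_min _ _ (Finset.mem_insert_self _ _), weightA_none, weightB_none]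
  omega

theorem map_some_erase (E : Finset V) (v : V) :
    (E.map Function.Embedding.some).erase (some v) =
      (E.erase v).map Function.Embedding.some :=
  (Finset.map_erase Function.Embedding.some E v).symm

theorem natCast_expA_some (K : G.Char) (s : ℤ) (E : Finset V) (v : V) :
    ((G.blowUpEdge v₁ v₂).expA (some v) (G.liftChar v₁ v₂ K s)
      (E.map Function.Embedding.some) : ℤ) =
      G.colWeight v₁ v₂ K (E.erase v) s - G.colWeight v₁ v₂ K E s := by
  rw [natCast_expA, weightA, map_some_erase, colWeight, colWeight]
  ring

variable {v₁ v₂}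

theorem natCast_expB_some (hedge : G.graph.Adj v₁ v₂) (K : G.Char) (s : ℤ) {E : Finset V} {v : V}
    (hv : v ∈ E) :
    ((G.blowUpEdge v₁ v₂).expB (some v) (G.liftChar v₁ v₂ K s)
      (E.map Function.Embedding.some) : ℤ) =
      G.weight K {v} + G.colWeight v₁ v₂ (G.shift v K) (E.erase v) (s - excMult v₁ v₂ v) -
        G.colWeight v₁ v₂ K E s := by
  have hv' : some v ∈ E.map Function.Embedding.some := Finset.mem_map.2 ⟨v, hv, rfl⟩
  rw [natCast_expB _ _ hv', weightB_eq,
    map_some_erase, G.weight_liftChar_some hedge, G.shift_some_liftChar hedge, colWeight,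
    colWeight]
  ring

theorem boundary_baseGen (hedge : G.graph.Adj v₁ v₂) (K : G.Char) (s : ℤ) (E : Finset V) :
    (G.blowUpEdge v₁ v₂).boundary (Finsupp.single (G.baseGen v₁ v₂ K s E) 1) =
      ∑ v ∈ E, (Finsupp.single (G.baseGen v₁ v₂ K s (E.erase v))
          (X ^ (G.blowUpEdge v₁ v₂).expA (some v) (G.liftChar v₁ v₂ K s)
            (E.map Function.Embedding.some)) +
        Finsupp.single (G.baseGen v₁ v₂ (G.shift v K) (s - excMult v₁ v₂ v) (E.erase v))
          (X ^ (G.blowUpEdge v₁ v₂).expB (some v) (G.liftChar v₁ v₂ K s)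
            (E.map Function.Embedding.some))) := by
  rw [baseGen, boundary_single, one_smul, Finset.sum_map]
  refine Finset.sum_congr rfl fun v _ => ?_
  rw [Function.Embedding.some_apply, map_some_erase, G.shift_some_liftChar hedge]
  rfl

theorem boundary_vertGen (hedge : G.graph.Adj v₁ v₂) (K : G.Char) (s : ℤ) (E : Finset V) :
    (G.blowUpEdge v₁ v₂).boundary (Finsupp.single (G.vertGen v₁ v₂ K s E) 1) =
      (Finsupp.single (G.baseGen v₁ v₂ K s E)
          (X ^ (G.blowUpEdge v₁ v₂).expA none (G.liftChar v₁ v₂ K s)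
            (insert none (E.map Function.Embedding.some))) +
        Finsupp.single (G.baseGen v₁ v₂ K (s + 1) E)
          (X ^ (G.blowUpEdge v₁ v₂).expB none (G.liftChar v₁ v₂ K s)
            (insert none (E.map Function.Embedding.some)))) +
      ∑ v ∈ E, (Finsupp.single (G.vertGen v₁ v₂ K s (E.erase v))
          (X ^ (G.blowUpEdge v₁ v₂).expA (some v) (G.liftChar v₁ v₂ K s)
            (insert none (E.map Function.Embedding.some))) +
        Finsupp.single (G.vertGen v₁ v₂ (G.shift v K) (s - excMult v₁ v₂ v) (E.erase v))
          (X ^ (G.blowUpEdge v₁ v₂).expB (some v) (G.liftChar v₁ v₂ K s)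
            (insert none (E.map Function.Embedding.some)))) := by
  rw [vertGen, boundary_single, one_smul, Finset.sum_insert (none_notMem_map_some E),
    Finset.sum_map]
  congr 1
  · rw [Finset.erase_insert (none_notMem_map_some E), shift_none_liftChar]
    rfl
  · refine Finset.sum_congr rfl fun v _ => ?_
    rw [Function.Embedding.some_apply, Finset.erase_insert_of_ne (by simp), map_some_erase,
      G.shift_some_liftChar hedge]
    rfl

/-! ### The blow-down chain map -/

variable (v₁ v₂)

/-- The exponent of `U` in the projection of the generator at height `s` over `[K, E]`. -/
noncomputable def projExp (K : G.Char) (E : Finset V) (s : ℤ) : ℕ :=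
  (G.minWeight K E - G.colWeight v₁ v₂ K E s).toNat

/-- The projection `CF⁻(G') → CF⁻(G)` along the exceptional direction. -/
noncomputable def blowDown :
    (G.blowUpEdge v₁ v₂).LatticeComplex →ₗ[LatticeField[X]] G.LatticeComplex :=
  Finsupp.linearCombination LatticeField[X] fun p =>
    if none ∈ p.2 then 0 else
      Finsupp.single (G.projChar v₁ v₂ p.1, p.2.eraseNone)
        (X ^ G.projExp v₁ v₂ (G.projChar v₁ v₂ p.1) p.2.eraseNone (G.excCoord v₁ v₂ p.1))

theorem blowDown_baseGen (K : G.Char) (s : ℤ) (E : Finset V) (r : LatticeField[X]) :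
    G.blowDown v₁ v₂ (Finsupp.single (G.baseGen v₁ v₂ K s E) r) =
      Finsupp.single (K, E) (r * X ^ G.projExp v₁ v₂ K E s) := by
  rw [blowDown, Finsupp.linearCombination_single, baseGen, if_neg (none_notMem_map_some E)]
  simp only [projChar_liftChar, excCoord_liftChar, Finset.eraseNone_map_some, Finsupp.smul_single,
    smul_eq_mul]

theorem blowDown_vertGen (K : G.Char) (s : ℤ) (E : Finset V) (r : LatticeField[X]) :
    G.blowDown v₁ v₂ (Finsupp.single (G.vertGen v₁ v₂ K s E) r) = 0 := by
  rw [blowDown, Finsupp.linearCombination_single, vertGen, if_pos (Finset.mem_insert_self _ _),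
    smul_zero]

variable {v₁ v₂}

theorem natCast_projExp (hedge : G.graph.Adj v₁ v₂) (K : G.Char) (E : Finset V) (s : ℤ) :
    (G.projExp v₁ v₂ K E s : ℤ) = G.minWeight K E - G.colWeight v₁ v₂ K E s :=
  Int.toNat_of_nonneg (sub_nonneg.2 (G.colWeight_le_minWeight hedge K E s))

/-- All exponents are differences of weights and telescope. The two ends of a vertical cube reach
the same power of `U`, so they cancel in characteristic 2; its other faces are vertical. -/
theorem blowDown_boundary (hedge : G.graph.Adj v₁ v₂) (c : (G.blowUpEdge v₁ v₂).LatticeComplex) :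
    G.blowDown v₁ v₂ ((G.blowUpEdge v₁ v₂).boundary c) = G.boundary (G.blowDown v₁ v₂ c) := by
  suffices h : G.blowDown v₁ v₂ ∘ₗ (G.blowUpEdge v₁ v₂).boundary =
      G.boundary ∘ₗ G.blowDown v₁ v₂ from LinearMap.congr_fun h c
  refine Finsupp.lhom_ext' fun p => LinearMap.ext_ring ?_
  simp only [LinearMap.comp_apply, Finsupp.lsingle_apply]
  induction p using G.gen_cases v₁ v₂ with
  | base K s E =>
    rw [G.boundary_baseGen hedge, blowDown_baseGen, boundary_single, map_sum, Finset.smul_sum]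
    refine Finset.sum_congr rfl fun v hv => ?_
    rw [map_add, blowDown_baseGen, blowDown_baseGen, one_mul, smul_add, Finsupp.smul_single,
      Finsupp.smul_single, smul_eq_mul, smul_eq_mul, ← pow_add, ← pow_add, ← pow_add, ← pow_add]
    have h1 := G.natCast_projExp hedge K E s
    have h2 := G.natCast_projExp hedge K (E.erase v) s
    have h3 := G.natCast_projExp hedge (G.shift v K) (E.erase v) (s - excMult v₁ v₂ v)
    have h4 := G.natCast_expA_some v₁ v₂ K s E v
    have h5 := G.natCast_expB_some hedge K s hv
    have h6 := G.natCast_expA v K E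
    have h7 := G.natCast_expB K hv
    rw [weightA] at h6
    rw [weightB_eq] at h7
    congr 3 <;> omega
  | vert K s E =>
    rw [G.boundary_vertGen hedge, blowDown_vertGen, map_zero, map_add, map_add, blowDown_baseGen,
      blowDown_baseGen, map_sum, Finset.sum_eq_zero, add_zero, ← Finsupp.single_add, ← pow_add,
      ← pow_add]
    · have h1 := G.natCast_projExp hedge K E s
      have h2 := G.natCast_projExp hedge K E (s + 1)
      have h3 := G.natCast_expA_none v₁ v₂ K s E
      have h4 := G.natCast_expB_none v₁ v₂ K s E
      rw [Finsupp.single_eq_zero]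
      refine (congrArg (_ + ·) (congrArg _ ?_)).trans (CharTwo.add_self_eq_zero _)
      omega
    · intro v _
      rw [map_add, blowDown_vertGen, blowDown_vertGen, add_zero]

/-! ### Vertical chains and reduction to column maxima -/

variable (v₁ v₂)

/-- The chains spanned by the generators that contain the exceptional direction. -/
noncomputable def vertChains :
    Submodule LatticeField[X] (G.blowUpEdge v₁ v₂).LatticeComplex :=
  Submodule.span _ {c | ∃ K s E, c = Finsupp.single (G.vertGen v₁ v₂ K s E) 1}

theorem single_vertGen_mem (K : G.Char) (s : ℤ) (E : Finset V) (r : LatticeField[X]) :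
    Finsupp.single (G.vertGen v₁ v₂ K s E) r ∈ G.vertChains v₁ v₂ := by
  rw [← mul_one r, ← smul_eq_mul, ← Finsupp.smul_single]
  exact Submodule.smul_mem _ _ (Submodule.subset_span ⟨K, s, E, rfl⟩)

theorem blowDown_eq_zero_of_mem_vertChains {c : (G.blowUpEdge v₁ v₂).LatticeComplex}
    (hc : c ∈ G.vertChains v₁ v₂) : G.blowDown v₁ v₂ c = 0 := by
  have : G.vertChains v₁ v₂ ≤ LinearMap.ker (G.blowDown v₁ v₂) := by
    refine Submodule.span_le.2 ?_
    rintro _ ⟨K, s, E, rfl⟩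
    exact G.blowDown_vertGen v₁ v₂ K s E 1
  exact this hc

theorem apply_baseGen_of_mem_vertChains {c : (G.blowUpEdge v₁ v₂).LatticeComplex}
    (hc : c ∈ G.vertChains v₁ v₂) (K : G.Char) (s : ℤ) (E : Finset V) :
    c (G.baseGen v₁ v₂ K s E) = 0 := by
  induction hc using Submodule.span_induction with
  | mem x hx =>
    obtain ⟨L, t, F, rfl⟩ := hx
    exact Finsupp.single_eq_of_ne (G.vertGen_ne_baseGen v₁ v₂).symm
  | zero => rfl
  | add x y _ _ hx hy => rw [Finsupp.add_apply, hx, hy, add_zero]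
  | smul a x _ hx => rw [Finsupp.smul_apply, hx, smul_zero]

variable {v₁ v₂}

/-- Only the vertical cubes just above and just below a base generator have it as a face. -/
theorem boundary_apply_baseGen (hedge : G.graph.Adj v₁ v₂)
    {c : (G.blowUpEdge v₁ v₂).LatticeComplex}
    (hc : c ∈ G.vertChains v₁ v₂) (K : G.Char) (s : ℤ) (E : Finset V) :
    (G.blowUpEdge v₁ v₂).boundary c (G.baseGen v₁ v₂ K (s + 1) E) =
      c (G.vertGen v₁ v₂ K (s + 1) E) *
          X ^ (G.blowUpEdge v₁ v₂).expA none (G.liftChar v₁ v₂ K (s + 1))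
            (insert none (E.map Function.Embedding.some)) +
        c (G.vertGen v₁ v₂ K s E) *
          X ^ (G.blowUpEdge v₁ v₂).expB none (G.liftChar v₁ v₂ K s)
            (insert none (E.map Function.Embedding.some)) := by
  classical
  induction hc using Submodule.span_induction with
  | mem x hx =>
    obtain ⟨L, t, F, rfl⟩ := hx
    have hsum : ∀ (x : (G.blowUpEdge v₁ v₂).LatticeComplex), x ∈ G.vertChains v₁ v₂ →
      ∀ y : (G.blowUpEdge v₁ v₂).LatticeComplex, (y + x) (G.baseGen v₁ v₂ K (s + 1) E) =
        y (G.baseGen v₁ v₂ K (s + 1) E) := fun x hx y => by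
      rw [Finsupp.add_apply, G.apply_baseGen_of_mem_vertChains v₁ v₂ hx, add_zero]
    rw [G.boundary_vertGen hedge, hsum _ (sum_mem fun v _ => add_mem
      (G.single_vertGen_mem v₁ v₂ _ _ _ _) (G.single_vertGen_mem v₁ v₂ _ _ _ _)),
      Finsupp.add_apply]
    simp only [Finsupp.single_apply, baseGen_inj, vertGen_inj, ite_mul, one_mul, zero_mul,
      add_left_inj]
    congr 1
    · split_ifs with h
      · obtain ⟨rfl, rfl, rfl⟩ := h; rfl
      · rfl
    · split_ifs with h
      · obtain ⟨rfl, rfl, rfl⟩ := h; rfl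
      · rfl
  | zero => simp
  | add x y _ _ hx hy => rw [map_add, Finsupp.add_apply, hx, hy, Finsupp.add_apply,
      Finsupp.add_apply]; ring
  | smul a x _ hx => rw [map_smul, Finsupp.smul_apply, hx, Finsupp.smul_apply, Finsupp.smul_apply,
      smul_eq_mul, smul_eq_mul, smul_eq_mul]; ring

/-- At each base generator of the boundary the two neighbouring coefficients must cancel, so a
nonzero coefficient propagates up the whole column, against finite support. -/
theorem eq_zero_of_mem_vertChains (hedge : G.graph.Adj v₁ v₂)
    {c : (G.blowUpEdge v₁ v₂).LatticeComplex}
    (hc : c ∈ G.vertChains v₁ v₂) (hd : (G.blowUpEdge v₁ v₂).boundary c = 0) : c = 0 := by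
  ext1 p
  induction p using G.gen_cases v₁ v₂ with
  | base K s E => exact G.apply_baseGen_of_mem_vertChains v₁ v₂ hc K s E
  | vert K s E =>
    by_contra h0
    have step : ∀ t : ℤ, c (G.vertGen v₁ v₂ K t E) ≠ 0 → c (G.vertGen v₁ v₂ K (t + 1) E) ≠ 0 := by
      intro t ht ht'
      have := G.boundary_apply_baseGen hedge hc K t E
      rw [hd, ht', zero_mul, zero_add] at this
      exact mul_ne_zero ht (pow_ne_zero _ X_ne_zero) this.symm
    have all : ∀ n : ℕ, c (G.vertGen v₁ v₂ K (s + n) E) ≠ 0 := by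
      intro n
      induction n with
      | zero => simpa using h0
      | succ n ih => simpa [add_assoc] using step _ ih
    refine Set.infinite_of_injective_forall_mem (s := (c.support : Set _))
      (f := fun n : ℕ => G.vertGen v₁ v₂ K (s + n) E) ?_ (fun n => by simpa using all n)
      c.support.finite_toSet
    intro m n hmn
    have := ((G.vertGen_inj v₁ v₂).1 hmn).2.1
    omega

/-- The two ends of a vertical generator agree modulo vertical chains and their boundaries. -/
theorem single_add_single_mem (hedge : G.graph.Adj v₁ v₂) (K : G.Char) (s : ℤ) (E : Finset V) :
    Finsupp.single (G.baseGen v₁ v₂ K s E)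
          (X ^ (G.blowUpEdge v₁ v₂).expA none (G.liftChar v₁ v₂ K s)
            (insert none (E.map Function.Embedding.some))) +
        Finsupp.single (G.baseGen v₁ v₂ K (s + 1) E)
          (X ^ (G.blowUpEdge v₁ v₂).expB none (G.liftChar v₁ v₂ K s)
            (insert none (E.map Function.Embedding.some))) ∈
      (G.vertChains v₁ v₂).map (G.blowUpEdge v₁ v₂).boundary ⊔ G.vertChains v₁ v₂ := by
  rw [← add_sub_cancel_right (_ + _), ← G.boundary_vertGen hedge]
  refine sub_mem (Submodule.mem_sup_left ⟨_, G.single_vertGen_mem v₁ v₂ K s E 1, rfl⟩)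
    (Submodule.mem_sup_right ?_)
  exact sum_mem fun v _ => add_mem
      (G.single_vertGen_mem v₁ v₂ _ _ _ _) (G.single_vertGen_mem v₁ v₂ _ _ _ _)

theorem neg_eq_self_latticeComplex {V : Type*} (G : PlumbingGraph V) (c : G.LatticeComplex) : -c = c := by
  ext1 p
  exact CharTwo.neg_eq _

/-- Modulo vertical chains and their boundaries, every generator is a multiple of a maximal one in
its column. -/
theorem single_sub_single_mem (hedge : G.graph.Adj v₁ v₂) (K : G.Char) (E : Finset V) {t : ℤ}
    (ht : G.colWeight v₁ v₂ K E t = G.minWeight K E) (s : ℤ) :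
    Finsupp.single (G.baseGen v₁ v₂ K s E) 1 -
        Finsupp.single (G.baseGen v₁ v₂ K t E) (X ^ G.projExp v₁ v₂ K E s) ∈
      (G.vertChains v₁ v₂).map (G.blowUpEdge v₁ v₂).boundary ⊔ G.vertChains v₁ v₂ := by
  induction s using Int.inductionOn' (b := t) with
  | zero =>
    rw [projExp, ht, sub_self]
    simp
  | succ s hs ih =>
    have hw := G.colWeight_add_one_le hedge K E ht hs
    have h1 := G.single_add_single_mem hedge K s E
    have eA := G.natCast_expA_none v₁ v₂ K s E
    have eB := G.natCast_expB_none v₁ v₂ K s E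
    have p1 := G.natCast_projExp hedge K E s
    have p2 := G.natCast_projExp hedge K E (s + 1)
    rw [min_eq_right hw] at eA eB
    generalize (G.blowUpEdge v₁ v₂).expA none _ _ = a at *
    generalize (G.blowUpEdge v₁ v₂).expB none _ _ = b at *
    -- Moving away from the maximum, the farther end has the smaller weight and thus coefficient 1,
    -- so it can be solved for.
    obtain rfl : b = 0 := by omega
    have h2 := sub_mem h1 (Submodule.smul_mem _ (X ^ a : LatticeField[X]) ih)
    have h3 : G.projExp v₁ v₂ K E (s + 1) = a + G.projExp v₁ v₂ K E s := by omega
    rw [smul_sub, Finsupp.smul_single, Finsupp.smul_single, smul_eq_mul, smul_eq_mul, mul_one,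
      ← pow_add, ← h3, pow_zero] at h2
    convert h2 using 1
    rw [sub_eq_add_neg, neg_eq_self_latticeComplex]
    abel
  | pred s hs ih =>
    have hw := G.colWeight_le_add_one hedge K E (s := s - 1) ht (by linarith)
    have h1 := G.single_add_single_mem hedge K (s - 1) E
    have eA := G.natCast_expA_none v₁ v₂ K (s - 1) E
    have eB := G.natCast_expB_none v₁ v₂ K (s - 1) E
    have p1 := G.natCast_projExp hedge K E s
    have p2 := G.natCast_projExp hedge K E (s - 1)
    rw [min_eq_left hw] at eA eB
    rw [sub_add_cancel] at eB h1
    generalize (G.blowUpEdge v₁ v₂).expA none _ _ = a at *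
    generalize (G.blowUpEdge v₁ v₂).expB none _ _ = b at *
    obtain rfl : a = 0 := by omega
    have h2 := sub_mem h1 (Submodule.smul_mem _ (X ^ b : LatticeField[X]) ih)
    have h3 : G.projExp v₁ v₂ K E (s - 1) = b + G.projExp v₁ v₂ K E s := by omega
    rw [smul_sub, Finsupp.smul_single, Finsupp.smul_single, smul_eq_mul, smul_eq_mul, mul_one,
      ← pow_add, ← h3, pow_zero] at h2
    convert h2 using 1
    rw [sub_eq_add_neg, neg_eq_self_latticeComplex]
    abel

end PlumbingGraph

/-! ### The quasi-isomorphism -/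

namespace PlumbingGraph

section BlowDown

variable {V : Type*} [DecidableEq V] (G : PlumbingGraph V) {v₁ v₂ : V} [Fintype V]

/-- `Q` sends `[K, E]` to a maximal generator of its column, where the projection has exponent 0.
Linearity suffices; `Q` need not be a chain map. -/
theorem exists_blowDown_section (hforest : G.graph.IsAcyclic) (hedge : G.graph.Adj v₁ v₂) :
    ∃ Q : G.LatticeComplex →ₗ[LatticeField[X]] (G.blowUpEdge v₁ v₂).LatticeComplex,
      (∀ c, G.blowDown v₁ v₂ (Q c) = c) ∧ ∀ c, c - Q (G.blowDown v₁ v₂ c) ∈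
        (G.vertChains v₁ v₂).map (G.blowUpEdge v₁ v₂).boundary ⊔ G.vertChains v₁ v₂ := by
  choose t ht using G.exists_colWeight_eq_minWeight hforest hedge
  have hQ : ∀ K E r, Finsupp.linearCombination LatticeField[X]
      (fun p : G.Char × Finset V => Finsupp.single (G.baseGen v₁ v₂ p.1 (t p.1 p.2) p.2)
        (1 : LatticeField[X])) (Finsupp.single (K, E) r) =
      Finsupp.single (G.baseGen v₁ v₂ K (t K E) E) r := by
    intro K E r
    simp
  refine ⟨Finsupp.linearCombination LatticeField[X] fun p =>
    Finsupp.single (G.baseGen v₁ v₂ p.1 (t p.1 p.2) p.2) 1, fun c => ?_, fun c => ?_⟩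
  · induction c using Finsupp.induction_linear with
    | zero => simp
    | add x y hx hy => rw [map_add, map_add, hx, hy]
    | single p r =>
      rw [hQ, blowDown_baseGen, projExp, ht, sub_self]
      simp
  · induction c using Finsupp.induction_linear with
    | zero => simp
    | add x y hx hy => rw [map_add, map_add, add_sub_add_comm]; exact add_mem hx hy
    | single p r =>
      induction p using G.gen_cases v₁ v₂ with
      | base K s E =>
        rw [blowDown_baseGen, hQ]
        have := Submodule.smul_mem _ r (G.single_sub_single_mem hedge K E (ht K E) s)
        rwa [smul_sub, Finsupp.smul_single, Finsupp.smul_single, smul_eq_mul, smul_eq_mul,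
          mul_one] at this
      | vert K s E =>
        rw [blowDown_vertGen, map_zero, sub_zero]
        exact Submodule.mem_sup_right (G.single_vertGen_mem v₁ v₂ K s E r)

/-- The projection along the exceptional direction is a quasi-isomorphism. -/
theorem blowDown_homologyMap_bijective (hforest : G.graph.IsAcyclic)
    (hedge : G.graph.Adj v₁ v₂) :
    Function.Bijective (homologyMap (G.blowDown v₁ v₂) (G.blowDown_boundary hedge)) := by
  obtain ⟨Q, hPQ, hQP⟩ := G.exists_blowDown_section hforest hedge
  refine homologyMap_bijective (boundary_boundary _) _ _ (fun c => ⟨Q c, hPQ c⟩) fun z hz hdz => ?_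
  have h := hQP z
  rw [hz, map_zero, sub_zero] at h
  obtain ⟨_, ⟨a, ha, rfl⟩, b, hb, hab⟩ := Submodule.mem_sup.1 h
  refine ⟨a, G.blowDown_eq_zero_of_mem_vertChains v₁ v₂ ha, ?_⟩
  have : b = 0 := by
    refine G.eq_zero_of_mem_vertChains hedge hb ?_
    rw [← hab, map_add, boundary_boundary, zero_add] at hdz
    exact hdz
  rw [← hab, this, add_zero]

/-! ### Spin^c structures and gradings under the blow-up -/

theorem spinc_projChar (hedge : G.graph.Adj v₁ v₂) {K K' : (G.blowUpEdge v₁ v₂).Char}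
    (h : (G.blowUpEdge v₁ v₂).spincSetoid K K') :
    G.spincSetoid (G.projChar v₁ v₂ K) (G.projChar v₁ v₂ K') := by
  obtain ⟨x, hx⟩ := h
  refine ⟨fun v => x (some v), fun w => ?_⟩
  have h1 := hx (some w)
  have h2 := hx none
  simp only [Fintype.sum_option, blowUpEdge_interMatrix_none_none,
    blowUpEdge_interMatrix_none_some, blowUpEdge_interMatrix_some_none,
    G.blowUpEdge_interMatrix_some_some hedge, mul_sub, Finset.sum_sub_distrib, ← mul_assoc,
    ← Finset.sum_mul] at h1 h2
  rw [projChar_apply, projChar_apply, h1, h2]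
  ring

theorem spinc_liftChar (hedge : G.graph.Adj v₁ v₂) {K K' : G.Char} (h : G.spincSetoid K K') :
    (G.blowUpEdge v₁ v₂).spincSetoid (G.liftChar v₁ v₂ K 0) (G.liftChar v₁ v₂ K' 0) := by
  obtain ⟨x, hx⟩ := h
  -- The total transform of `x`, which keeps the height fixed.
  refine ⟨fun a => a.elim (∑ v, x v * excMult v₁ v₂ v) x, fun a => ?_⟩
  match a with
  | none =>
    simp only [liftChar_none, Fintype.sum_option, blowUpEdge_interMatrix_none_none,
      blowUpEdge_interMatrix_some_none, Option.elim]
    ring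
  | some w =>
    simp only [liftChar_some, Fintype.sum_option, blowUpEdge_interMatrix_none_some, Option.elim,
      G.blowUpEdge_interMatrix_some_some hedge, mul_sub, Finset.sum_sub_distrib, ← mul_assoc,
      ← Finset.sum_mul, hx w]
    ring

theorem spinc_liftChar_projChar (K : (G.blowUpEdge v₁ v₂).Char) :
    (G.blowUpEdge v₁ v₂).spincSetoid (G.liftChar v₁ v₂ (G.projChar v₁ v₂ K) 0) K := by
  have h := G.one_sub_two_mul_excCoord v₁ v₂ K
  -- Adding `2e^*` as many times as the height of `K` climbs from height 0 to `K`.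
  refine ⟨fun a => a.elim (G.excCoord v₁ v₂ K) 0, fun a => ?_⟩
  match a with
  | none =>
    simp only [liftChar_none, Fintype.sum_option, blowUpEdge_interMatrix_none_none, Option.elim]
    simp only [Pi.zero_apply, zero_mul, Finset.sum_const_zero]
    linarith
  | some w =>
    simp only [liftChar_some, Fintype.sum_option, blowUpEdge_interMatrix_none_some, Option.elim,
      projChar_apply, ← h]
    simp only [Pi.zero_apply, zero_mul, Finset.sum_const_zero]
    ring

/-- The spin^c structures of a graph and of its blow-up correspond. -/
noncomputable def spincBlowUp (hedge : G.graph.Adj v₁ v₂) :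
    G.SpinC ≃ (G.blowUpEdge v₁ v₂).SpinC where
  toFun := Quotient.map' (s₁ := G.spincSetoid) (s₂ := (G.blowUpEdge v₁ v₂).spincSetoid)
    (fun K => G.liftChar v₁ v₂ K 0) fun _ _ h => G.spinc_liftChar hedge h
  invFun := Quotient.map' (s₁ := (G.blowUpEdge v₁ v₂).spincSetoid) (s₂ := G.spincSetoid)
    (G.projChar v₁ v₂) fun _ _ h => G.spinc_projChar hedge h
  left_inv s := by
    refine Quotient.inductionOn (s := G.spincSetoid) s fun K => ?_
    exact congrArg G.spinc (G.projChar_liftChar v₁ v₂ K 0)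
  right_inv s := by
    refine Quotient.inductionOn (s := (G.blowUpEdge v₁ v₂).spincSetoid) s fun K => ?_
    exact Quotient.sound (s := (G.blowUpEdge v₁ v₂).spincSetoid) (G.spinc_liftChar_projChar K)

theorem spincBlowUp_spinc (hedge : G.graph.Adj v₁ v₂) (K : G.Char) (s : ℤ) :
    G.spincBlowUp hedge (G.spinc K) = (G.blowUpEdge v₁ v₂).spinc (G.liftChar v₁ v₂ K s) := by
  rw [← Equiv.eq_symm_apply]
  exact congrArg G.spinc (G.projChar_liftChar v₁ v₂ K s).symm

/-- The equation at `e` fixes the exceptional coefficient, and substituting it turns the others into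
the system of `G`. -/
theorem blowUpEdge_dual (hedge : G.graph.Adj v₁ v₂) (k : Option V → ℚ) (y : V → ℚ)
    (hy : ∀ w, ∑ v, (G.interMatrix w v : ℚ) * y v = k (some w) + excMult v₁ v₂ w * k none)
    (a : Option V) :
    ∑ b, ((G.blowUpEdge v₁ v₂).interMatrix a b : ℚ) *
      b.elim (∑ v, (excMult v₁ v₂ v : ℚ) * y v - k none) y = k a := by
  match a with
  | none =>
    simp only [Fintype.sum_option, blowUpEdge_interMatrix_none_none, Option.elim,
      blowUpEdge_interMatrix_none_some]
    push_cast
    ring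
  | some w =>
    simp only [Fintype.sum_option, blowUpEdge_interMatrix_some_none, Option.elim,
      G.blowUpEdge_interMatrix_some_some hedge, Int.cast_sub, Int.cast_mul, sub_mul,
      Finset.sum_sub_distrib, mul_assoc, ← Finset.mul_sum, hy]
    ring

theorem isUnit_blowUpEdge_interMatrix (hedge : G.graph.Adj v₁ v₂)
    (h : IsUnit (G.interMatrix.map (Int.cast : ℤ → ℚ))) :
    IsUnit ((G.blowUpEdge v₁ v₂).interMatrix.map (Int.cast : ℤ → ℚ)) := by
  rw [← Matrix.mulVec_surjective_iff_isUnit]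
  intro k
  obtain ⟨y, hy⟩ := G.exists_dual h fun w => k (some w) + excMult v₁ v₂ w * k none
  exact ⟨_, funext (G.blowUpEdge_dual hedge k y hy)⟩

theorem charSq_liftChar (hedge : G.graph.Adj v₁ v₂)
    (h : IsUnit (G.interMatrix.map (Int.cast : ℤ → ℚ))) (K : G.Char) (s : ℤ) :
    (G.blowUpEdge v₁ v₂).charSq (G.liftChar v₁ v₂ K s) = G.charSq K - (1 - 2 * s) ^ 2 := by
  obtain ⟨y, hy⟩ := G.exists_dual h fun w => (K.1 w : ℚ)
  rw [G.charSq_eq h K y hy, charSq_eq _ (G.isUnit_blowUpEdge_interMatrix hedge h) _ _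
    (G.blowUpEdge_dual hedge (fun a => ((G.liftChar v₁ v₂ K s).1 a : ℚ)) y fun w => ?_)]
  · simp only [Fintype.sum_option, Option.elim, liftChar_none, liftChar_some, Int.cast_sub,
      Int.cast_mul, sub_mul, Finset.sum_sub_distrib]
    have : ∑ v, (excMult v₁ v₂ v : ℚ) * ((1 : ℤ) - (2 : ℤ) * s) * y v =
        (1 - 2 * s) * ∑ v, (excMult v₁ v₂ v : ℚ) * y v := by
      rw [Finset.mul_sum]
      refine Finset.sum_congr rfl fun v _ => ?_
      push_cast
      ring
    rw [this]
    push_cast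
    ring
  · rw [hy w, liftChar_none, liftChar_some]
    push_cast
    ring

/-- `(1 - 2s)² = 1 - 8 excWeight s`: the 1 is offset by the additional vertex, and the rest turns
the minimal weight into `colWeight`. -/
theorem maslov_liftChar (hedge : G.graph.Adj v₁ v₂)
    (h : IsUnit (G.interMatrix.map (Int.cast : ℤ → ℚ))) (K : G.Char) (s : ℤ) (E : Finset V)
    (j : ℕ) :
    G.maslov (j + G.projExp v₁ v₂ K E s) K E = (G.blowUpEdge v₁ v₂).maslov j
      (G.liftChar v₁ v₂ K s) (E.map Function.Embedding.some) := by
  have e1 := congrArg (Int.cast : ℤ → ℚ) (G.natCast_projExp hedge K E s)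
  have e2 := congrArg (Int.cast : ℤ → ℚ) (two_mul_excWeight s)
  rw [colWeight] at e1
  simp only [maslov, G.charSq_liftChar hedge h, Finset.card_map, Fintype.card_option]
  push_cast at e1 e2 ⊢
  linarith

/-- The projection along the exceptional direction is homogeneous. -/
theorem blowDown_monomial_mem (hedge : G.graph.Adj v₁ v₂)
    (h : IsUnit (G.interMatrix.map (Int.cast : ℤ → ℚ))) (D : Set (G.SpinC × ℕ × ℚ)) (j : ℕ)
    (i : (G.blowUpEdge v₁ v₂).Char × Finset (Option V))
    (hi : ((G.spincBlowUp hedge).symm ((G.blowUpEdge v₁ v₂).spinc i.1), i.2.card,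
      (G.blowUpEdge v₁ v₂).maslov j i.1 i.2) ∈ D) :
    G.blowDown v₁ v₂ (Finsupp.single i (X ^ j)) ∈ monomialSpan LatticeField
      {p | (G.spinc p.2.1, p.2.2.card, G.maslov p.1 p.2.1 p.2.2) ∈ D} := by
  induction i using G.gen_cases v₁ v₂ with
  | base K s E =>
    rw [blowDown_baseGen, ← pow_add]
    refine single_mem_monomialSpan ?_
    simp only [baseGen, ← G.spincBlowUp_spinc hedge, Equiv.symm_apply_apply, Finset.card_map,
      ← G.maslov_liftChar hedge h] at hi
    exact hi
  | vert K s E =>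
    rw [blowDown_vertGen]
    exact zero_mem _

theorem mem_homogeneousPart_blowDown_iff (hforest : G.graph.IsAcyclic)
    (hedge : G.graph.Adj v₁ v₂) (h : IsUnit (G.interMatrix.map (Int.cast : ℤ → ℚ))) (s : G.SpinC)
    (k : ℕ) (q : ℚ) (y : (G.blowUpEdge v₁ v₂).LatticeHomology) :
    homologyMap (G.blowDown v₁ v₂) (G.blowDown_boundary hedge) y ∈ G.homogeneousPart s k q ↔
      y ∈ (G.blowUpEdge v₁ v₂).homogeneousPart (G.spincBlowUp hedge s) k q := by
  have h' := G.isUnit_blowUpEdge_interMatrix hedge h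
  have hset : ∀ (j : ℕ) (i : (G.blowUpEdge v₁ v₂).Char × Finset (Option V)),
      ((G.blowUpEdge v₁ v₂).spinc i.1, i.2.card, (G.blowUpEdge v₁ v₂).maslov j i.1 i.2) ∈
        ({(G.spincBlowUp hedge s, k, q)} : Set _) ↔
      ((G.spincBlowUp hedge).symm ((G.blowUpEdge v₁ v₂).spinc i.1), i.2.card,
        (G.blowUpEdge v₁ v₂).maslov j i.1 i.2) ∈ ({(s, k, q)} : Set _) := by
    intro j i
    simp [Equiv.symm_apply_eq]
  have hcyc : ∀ {z}, z ∈ LinearMap.ker (G.blowUpEdge v₁ v₂).boundary →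
      G.blowDown v₁ v₂ z ∈ LinearMap.ker G.boundary := fun {z} hz => by
    rw [LinearMap.mem_ker, ← G.blowDown_boundary hedge, LinearMap.mem_ker.1 hz, map_zero]
  rw [mem_homogeneousPart_iff, mem_homogeneousPart_iff]
  simp only [homogeneousChains_eq]
  constructor
  · rintro ⟨c, hc, hcS, hcy⟩
    obtain ⟨⟨z, hz⟩, rfl⟩ := Submodule.mkQ_surjective _ y
    change _ = homologyMap _ _ (homologyClass _ ⟨z, hz⟩) at hcy
    rw [homologyMap_homologyClass _ _ z hz (hcyc hz), ← sub_eq_zero, ← map_sub,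
      homologyClass_eq_zero_iff] at hcy
    obtain ⟨b, hb⟩ := hcy
    obtain ⟨Q, hPQ, -⟩ := G.exists_blowDown_section hforest hedge
    -- Adding `∂(Q b)` makes the cycle project to `c` itself, not merely to its class, so that its
    -- component in the given degree still projects to `c`.
    have hz' : (G.blowUpEdge v₁ v₂).boundary (z + (G.blowUpEdge v₁ v₂).boundary (Q b)) = 0 := by
      rw [map_add, boundary_boundary, LinearMap.mem_ker.1 hz, add_zero]
    have hPz' : G.blowDown v₁ v₂ (z + (G.blowUpEdge v₁ v₂).boundary (Q b)) = c := by
      rw [map_add, G.blowDown_boundary hedge, hPQ, hb]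
      simp
    obtain ⟨w, hwS, hw, hPw⟩ := exists_homogeneous_lift (G.blowDown v₁ v₂)
      (G.blowUpEdge v₁ v₂).boundary
      (S := {p | ((G.blowUpEdge v₁ v₂).spinc p.2.1, p.2.2.card,
        (G.blowUpEdge v₁ v₂).maslov p.1 p.2.1 p.2.2) ∈
          ({(G.spincBlowUp hedge s, k, q)} : Set _)})
      (S' := {p | ((G.blowUpEdge v₁ v₂).spinc p.2.1, p.2.2.card + 1,
        (G.blowUpEdge v₁ v₂).maslov p.1 p.2.1 p.2.2 + 1) ∈
          ({(G.spincBlowUp hedge s, k, q)} : Set _)})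
      (fun j i hi => G.blowDown_monomial_mem hedge h _ j i ((hset j i).1 hi))
      (fun j i hi => G.blowDown_monomial_mem hedge h {(s, k, q)}ᶜ j i (mt (hset j i).2 hi))
      (fun j i hi => boundary_monomial_mem _ h' {(G.spincBlowUp hedge s, k, q)} j i hi)
      (fun j i hi => boundary_monomial_mem _ h' {(G.spincBlowUp hedge s, k, q)}ᶜ j i hi) hz' (by rw [hPz']; exact hcS)
    -- Taking a component could change the class; injectivity on homology shows that it does not.
    refine ⟨w, hw, hwS, (G.blowDown_homologyMap_bijective hforest hedge).1 ?_⟩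
    change homologyMap _ _ (homologyClass _ _) = homologyMap _ _ (homologyClass _ ⟨z, hz⟩)
    rw [homologyMap_homologyClass _ _ w hw (hcyc hw), homologyMap_homologyClass _ _ z hz (hcyc hz),
      ← sub_eq_zero, ← map_sub, homologyClass_eq_zero_iff]
    refine ⟨b, ?_⟩
    rw [hb]
    simp [hPw, hPz']
  · rintro ⟨z, hz, hzS, rfl⟩
    refine ⟨G.blowDown v₁ v₂ z, hcyc hz, ?_, rfl⟩
    exact map_mem_monomialSpan _
      (fun j i hi => G.blowDown_monomial_mem hedge h _ j i ((hset j i).1 hi)) hzS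

end BlowDown

end PlumbingGraph

theorem mainTheorem7 {V : Type*} [Fintype V] [DecidableEq V] (G : PlumbingGraph V)
    (hforest : G.graph.IsAcyclic) (hneg : G.NegDef) (v₁ v₂ : V) (hedge : G.graph.Adj v₁ v₂) :
    ∃ (σ : G.SpinC ≃ (G.blowUpEdge v₁ v₂).SpinC)
      (Φ : G.LatticeHomology ≃ₗ[LatticeField[X]] (G.blowUpEdge v₁ v₂).LatticeHomology),
      ∀ (s : G.SpinC) (k : ℕ) (q : ℚ) (x : G.LatticeHomology),
        x ∈ G.homogeneousPart s k q ↔ Φ x ∈ (G.blowUpEdge v₁ v₂).homogeneousPart (σ s) k q := by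
  let Ψ := LinearEquiv.ofBijective _ (G.blowDown_homologyMap_bijective hforest hedge)
  refine ⟨G.spincBlowUp hedge, Ψ.symm, fun s k q x => ?_⟩
  rw [← G.mem_homogeneousPart_blowDown_iff hforest hedge (G.isUnit_interMatrix hneg)]
  change _ ↔ Ψ (Ψ.symm x) ∈ _
  rw [LinearEquiv.apply_symm_apply]
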